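/- Work with formal operators $A=\sum_{j\in\mathbb Z}a_j(n,\mathbf t)\Lambda^j$, where $n\in\mathbb Z$, $\mathbf t=(t_1,t_2,\dots)$, each $a_j(n,\cdot)\in\mathbb C[[t_1,t_2,\dots]]$, $\Lambda f(n)=f(n+1)$, $\Delta=\Lambda-1$, $A^*=\sum_j\Lambda^{-j}a_j$, $A_{\ge 0}=\sum_{j\ge0}a_j\Lambda^j$ and $A_{<0}=\sum_{j<0}a_j\Lambda^j$. Write $\iota_{\Lambda^{\mp1}}A^{-1}$ for the inverse of $A$ expanded in powers of $\Lambda^{\mp1}$, and $\xi(\mathbf t,z)=\sum_{k\ge1}t_kz^k$. Let $S^+=\sum_{j\ge0}b_j(n,\mathbf t)\Lambda^{-j}$ and $S^-=\sum_{j\ge0}\Lambda^{-j}\bar b_j(n,\mathbf t)$ be wave operators of the large BKP hierarchy, that is, for all $k\ge1$, $$S^+\Lambda^{-1}S^-=\iota_{\Lambda^{-1}}(\Lambda-\Lambda^{-1})^{-1},\quad \partial_{t_k}S^+=B_kS^+-S^+\Lambda^k,\quad \partial_{t_k}S^-=\Lambda^kS^-+S^-B_k^*,$$ $$B_k=\Big((S^+\Lambda^{k-1}S^-)_{\ge0}+\big((S^+\Lambda^{k-1}S^-)^*\big)_{<0}\Big)(\Lambda-\Lambda^{-1}).$$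 Put $L^+=S^+\Lambda(S^+)^{-1}$, $L^-=(S^-)^*\Lambda^{-1}((S^-)^*)^{-1}$, $\Psi^+(n,\mathbf t,z)=S^+e^{\xi(\mathbf t,\Lambda)}(z^n)$ and $\Psi^-(n,\mathbf t,z)=(S^-)^*e^{-\xi(\mathbf t,\Lambda^{-1})}(z^{-n-1})$. Then each $b_0(n)$ is invertible. Define $\mathcal S_i,\mathcal L_i,\Psi_i,\Psi_i^*$ ($i=1,2$; wave functions taken at $(x,y)=(\mathbf t,-\mathbf t)$) in one of the following two ways. (I) With $T_1=b_0(n)^{-1}$: $\mathcal S_1=T_1S^+$, $\mathcal S_2=T_1(S^-)^*$, $\mathcal L_1=T_1L^+T_1^{-1}$, $\mathcal L_2=T_1L^-T_1^{-1}$, $\Psi_1=T_1\Psi^+(n,\mathbf t,z)$, $\Psi_2=z^{-1}T_1\Psi^-(n,\mathbf t,z^{-1})$, $\Psi_1^*=T_1^{-1}(\Lambda^{-1}-\Lambda)\big(\Psi^-(n,\mathbf t,z)\big)$, $\Psi_2^*=-z\,T_1^{-1}(\Lambda^{-1}-\Lambda)\big(\Psi^+(n,\mathbf t,z^{-1})\big)$.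 (II) With $T_2=b_0(n+1)^{-1}\Delta$: $\mathcal S_1=T_2S^+\Lambda^{-1}$, $\mathcal S_2=-T_2(S^-)^*$, $\mathcal L_1=T_2L^+\,\iota_{\Lambda^{-1}}T_2^{-1}$, $\mathcal L_2=T_2L^-\,\iota_{\Lambda}T_2^{-1}$, $\Psi_1=z^{-1}T_2\big(\Psi^+(n,\mathbf t,z)\big)$, $\Psi_2=-z^{-1}T_2\big(\Psi^-(n,\mathbf t,z^{-1})\big)$, $\Psi_1^*=z\,b_0(n+1)(\Lambda+1)\big(\Psi^-(n,\mathbf t,z)\big)$, $\Psi_2^*=z\,b_0(n+1)(\Lambda+1)\big(\Psi^+(n,\mathbf t,z^{-1})\big)$. In both cases: (a) These are Toda objects restricted to $(x,y)=(\mathbf t,-\mathbf t)$: $\mathcal S_1=1+\sum_{k\ge1}w_k\Lambda^{-k}$, $\mathcal S_2=\bar w_0+\sum_{k\ge1}\bar w_k\Lambda^k$ with $\bar w_0(n)$ invertible, $\mathcal L_1=\mathcal S_1\Lambda\mathcal S_1^{-1}=\Lambda+\sum_{j\ge0}u_j\Lambda^{-j}$, $\mathcal L_2=\mathcal S_2\Lambda^{-1}\mathcal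 S_2^{-1}=\bar u_{-1}\Lambda^{-1}+\sum_{j\ge0}\bar u_j\Lambda^j$ with $\bar u_{-1}(n)$ invertible, $\Psi_1=\mathcal S_1e^{\xi(\mathbf t,\Lambda)}(z^n)$, $\Psi_2=\mathcal S_2e^{-\xi(\mathbf t,\Lambda^{-1})}(z^n)$, $\Psi_1^*=(\mathcal S_1^{-1})^*e^{-\xi(\mathbf t,\Lambda^{-1})}(z^{-n})$, $\Psi_2^*=(\mathcal S_2^{-1})^*e^{\xi(\mathbf t,\Lambda)}(z^{-n})$. (b) The Toda bilinear equation holds: for all $n,n',\mathbf t,\mathbf t'$, with the residues understood as (well-defined) coefficients of formal series in $z$, $$\oint_{z=\infty}\frac{dz}{2\pi iz}\Psi_1(n;\mathbf t,-\mathbf t;z)\Psi_1^*(n';\mathbf t',-\mathbf t';z)=\oint_{z=0}\frac{dz}{2\pi iz}\Psi_2(n;\mathbf t,-\mathbf t;z)\Psi_2^*(n';\mathbf t',-\mathbf t';z).$$ (c) The Toda evolution equations hold: for all $k\ge1$, $\partial_{t_k}\mathcal L_i=[(\mathcal L_1^k)_{\ge0}-(\mathcal L_2^k)_{<0},\mathcal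 L_i]$ for $i=1,2$, $\partial_{t_k}\mathcal S_1=-\big((\mathcal L_1^k)_{<0}+(\mathcal L_2^k)_{<0}\big)\mathcal S_1$ and $\partial_{t_k}\mathcal S_2=\big((\mathcal L_1^k)_{\ge0}+(\mathcal L_2^k)_{\ge0}\big)\mathcal S_2$. (d) The sub-Toda constraints hold. In case (I), with $\Gamma_1=\bar w_0(n)^{-1}\Lambda$, $$\mathcal S_1\Lambda^{-1}\mathcal S_2^*=T_1\,\iota_{\Lambda^{-1}}(\Lambda-\Lambda^{-1})^{-1}\,T_1^*,\qquad \mathcal L_1^*(\Gamma_1-\Gamma_1^*)=(\Gamma_1-\Gamma_1^*)\mathcal L_2;$$ in case (II), $$\mathcal S_1\mathcal S_2^*=-T_2\,\iota_{\Lambda^{-1}}(\Lambda-\Lambda^{-1})^{-1}\,T_2^*,\qquad T_2\,\iota_\Lambda(\Lambda-\Lambda^{-1})^{-1}\,T_2^*\,\mathcal L_1^*=\mathcal L_2\,T_2\,\iota_\Lambda(\Lambda-\Lambda^{-1})^{-1}\,T_2^*.$$ -/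

import Mathlib

noncomputable section

namespace LargeBKP

/-- Functions of the times `t = (t_1, t_2, t_3, ...)`: formal power series over `ℂ`. -/
abbrev TimeSeries : Type := MvPowerSeries ℕ+ ℂ

/-! ### Pseudo-difference operators -/

/-- A formal operator `∑_j a_j(n, t) Λ^j`, where `coeff j n = a_j(n, t)`. -/
@[ext]
structure PDO : Type where
  coeff : ℤ → ℤ → TimeSeries

namespace PDO

instance : Zero PDO := ⟨⟨fun _ _ => 0⟩⟩
instance : Add PDO := ⟨fun A B => ⟨fun j n => A.coeff j n + B.coeff j n⟩⟩
instance : Neg PDO := ⟨fun A => ⟨fun j n => -A.coeff j n⟩⟩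
instance : Sub PDO := ⟨fun A B => ⟨fun j n => A.coeff j n - B.coeff j n⟩⟩

/-- Multiplication by the function `f(n, t)`. -/
def ofFun (f : ℤ → TimeSeries) : PDO := ⟨fun j n => if j = 0 then f n else 0⟩

/-- The power `Λ^k` of the shift operator `Λ(f(n)) = f(n+1)`. -/
def shift (k : ℤ) : PDO := ⟨fun j _ => if j = k then 1 else 0⟩

instance : One PDO := ⟨shift 0⟩

/-- The product determined by `Λ^i · f(n) = f(n+i) Λ^i`.  The sum has finitely many nonzero terms
whenever both factors are bounded on the same side, or one of them is a finite sum. -/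
instance : Mul PDO :=
  ⟨fun A B => ⟨fun j n => ∑ᶠ i : ℤ, A.coeff i n * B.coeff (j - i) (n + i)⟩⟩

instance : Pow PDO ℕ := ⟨fun A k => npowRec k A⟩

/-- The commutator `[A, B]`. -/
def comm (A B : PDO) : PDO := A * B - B * A

/-- The formal adjoint `(∑_j a_j(n) Λ^j)^* = ∑_j Λ^{-j} a_j(n)`. -/
def adj (A : PDO) : PDO := ⟨fun j n => A.coeff (-j) (n + j)⟩

/-- The part `A_{≥ m}`. -/
def ge (m : ℤ) (A : PDO) : PDO := ⟨fun j n => if m ≤ j then A.coeff j n else 0⟩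

/-- The part `A_{< m}`. -/
def lt (m : ℤ) (A : PDO) : PDO := ⟨fun j n => if j < m then A.coeff j n else 0⟩

/-- The coefficientwise derivative `∂A/∂t_k`. -/
def pd (k : ℕ+) (A : PDO) : PDO := ⟨fun j n => MvPowerSeries.pderiv ℂ k (A.coeff j n)⟩

/-- Operators in powers of `Λ^{-1}`: `∑_{j ≤ N} a_j(n) Λ^j`. -/
def IsDown (A : PDO) : Prop := ∃ N : ℤ, ∀ j n : ℤ, N < j → A.coeff j n = 0

/-- Operators in powers of `Λ`: `∑_{j ≥ N} a_j(n) Λ^j`. -/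
def IsUp (A : PDO) : Prop := ∃ N : ℤ, ∀ j n : ℤ, j < N → A.coeff j n = 0

open Classical in
/-- `ι_{Λ^{-1}} A^{-1}`: the (unique) two-sided inverse of `A` expanded in powers of `Λ^{-1}`
(`0` if there is none). -/
def invDown (A : PDO) : PDO :=
  if h : ∃ C : PDO, C.IsDown ∧ A * C = 1 ∧ C * A = 1 then h.choose else 0

open Classical in
/-- `ι_Λ A^{-1}`: the (unique) two-sided inverse of `A` expanded in powers of `Λ`
(`0` if there is none). -/
def invUp (A : PDO) : PDO :=
  if h : ∃ C : PDO, C.IsUp ∧ A * C = 1 ∧ C * A = 1 then h.choose else 0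

/-- `Λ - Λ^{-1}`. -/
def lamSub : PDO := shift 1 - shift (-1)

/-- `Δ = Λ - 1`. -/
def delta : PDO := shift 1 - 1

end PDO

/-! ### Wave functions -/

/-- Functions of `(n, t, z)`, formal in `z`: `F n m` is the coefficient of `z^m` at the site `n`. -/
abbrev ZFun : Type := ℤ → ℤ → TimeSeries

/-- The coefficient of `z^m` in `exp (ε ∑_{k ≥ 1} t_k z^k)`; its coefficient at the monomial
`∏ t_k^{α_k}` is `∏ ε^{α_k} / α_k!` if `∑ k α_k = m` and `0` otherwise. -/
def expXi (ε : ℂ) (m : ℤ) : TimeSeries := fun α =>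
  if (α.sum fun k a => ((k : ℕ) : ℤ) * (a : ℤ)) = m then
    α.prod fun _ a => ε ^ a / (a.factorial : ℂ)
  else 0

/-- The action of `∑_j a_j(n) Λ^j` on a function of `(n, t, z)`, the infinite sum being taken
coefficientwise in `t` and `z`. -/
def act (A : PDO) (F : ZFun) : ZFun := fun n m α =>
  ∑ᶠ j : ℤ, MvPowerSeries.coeff α (A.coeff j n * F (n + j) m)

/-- Multiplication by `z^k`. -/
def zmul (k : ℤ) (F : ZFun) : ZFun := fun n m => F n (m - k)

/-- The substitution `z ↦ z^{-1}`. -/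
def zinv (F : ZFun) : ZFun := fun n m => F n (-m)

/-- `e^{ε ξ(t, Λ)}(z^n) = e^{ε ξ(t, z)} z^n`. -/
def expUp (ε : ℂ) : ZFun := fun n m => expXi ε (m - n)

/-- `e^{ε ξ(t, Λ^{-1})}(z^n) = e^{ε ξ(t, z^{-1})} z^n`. -/
def expDown (ε : ℂ) : ZFun := fun n m => expXi ε (n - m)

/-- `e^{ε ξ(t, Λ^{-1})}(z^{-n}) = e^{ε ξ(t, z)} z^{-n}`. -/
def expDownNeg (ε : ℂ) : ZFun := fun n m => expXi ε (m + n)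

/-- `e^{ε ξ(t, Λ)}(z^{-n}) = e^{ε ξ(t, z^{-1})} z^{-n}`. -/
def expUpNeg (ε : ℂ) : ZFun := fun n m => expXi ε (-n - m)

/-- The terms of the constant coefficient in `z` of `F(n, t, z) G(n', t', z)`, at the monomial
`t^α t'^β`. -/
def resTerm (F G : ZFun) (n n' : ℤ) (α β : ℕ+ →₀ ℕ) (m : ℤ) : ℂ :=
  MvPowerSeries.coeff α (F n m) * MvPowerSeries.coeff β (G n' (-m))

/-- The coefficient of `t^α t'^β` in `∮ dz/(2πi z) F(n, t, z) G(n', t', z)`. -/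
def res (F G : ZFun) (n n' : ℤ) (α β : ℕ+ →₀ ℕ) : ℂ :=
  ∑ᶠ m : ℤ, resTerm F G n n' α β m

/-! ### The large BKP hierarchy -/

/-- `B_k = ((S⁺Λ^{k-1}S⁻)_{≥0} + ((S⁺Λ^{k-1}S⁻)^*)_{<0}) (Λ - Λ^{-1})`. -/
def bkpB (Sp Sm : PDO) (k : ℕ+) : PDO :=
  (PDO.ge 0 (Sp * PDO.shift (((k : ℕ) : ℤ) - 1) * Sm) +
    PDO.lt 0 (PDO.adj (Sp * PDO.shift (((k : ℕ) : ℤ) - 1) * Sm))) * PDO.lamSub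

/-- `S⁺ = ∑_{j≥0} b_j Λ^{-j}` and `S⁻ = ∑_{j≥0} Λ^{-j} \bar b_j` are wave operators of the large
BKP hierarchy. -/
structure IsWavePair (Sp Sm : PDO) : Prop where
  plus_form : ∀ j n : ℤ, 0 < j → Sp.coeff j n = 0
  minus_form : ∀ j n : ℤ, 0 < j → Sm.coeff j n = 0
  constraint : Sp * PDO.shift (-1) * Sm = PDO.invDown PDO.lamSub
  flow_plus : ∀ k : ℕ+,
    PDO.pd k Sp = bkpB Sp Sm k * Sp - Sp * PDO.shift ((k : ℕ) : ℤ)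
  flow_minus : ∀ k : ℕ+,
    PDO.pd k Sm = PDO.shift ((k : ℕ) : ℤ) * Sm + Sm * PDO.adj (bkpB Sp Sm k)

/-- `L⁺ = S⁺ Λ (S⁺)^{-1}`. -/
def laxPlus (Sp : PDO) : PDO := Sp * PDO.shift 1 * PDO.invDown Sp

/-- `L⁻ = (S⁻)^* Λ^{-1} ((S⁻)^*)^{-1}`. -/
def laxMinus (Sm : PDO) : PDO := PDO.adj Sm * PDO.shift (-1) * PDO.invUp (PDO.adj Sm)

/-- `Ψ⁺(n, t, z) = S⁺ e^{ξ(t, Λ)}(z^n)`. -/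
def wavePlus (Sp : PDO) : ZFun := act Sp (expUp 1)

/-- `Ψ⁻(n, t, z) = (e^{-ξ(t, Λ)} S⁻)^*(z^{-n-1}) = (S⁻)^* e^{-ξ(t, Λ^{-1})}(z^{-n-1})`. -/
def waveMinus (Sm : PDO) : ZFun := act (PDO.adj Sm) (zmul (-1) (expDownNeg (-1)))

/-- The coefficient `b_0(n)` of `Λ^0` in `S⁺`. -/
def b0 (Sp : PDO) (n : ℤ) : TimeSeries := Sp.coeff 0 n

/-! ### Toda objects restricted to `(x, y) = (t, -t)` -/

/-- A tuple of Toda-type wave operators, Lax operators, wave functions and adjoint wave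
functions, all evaluated at `(x, y) = (t, -t)`. -/
structure TodaObjects : Type where
  S₁ : PDO
  S₂ : PDO
  L₁ : PDO
  L₂ : PDO
  Psi₁ : ZFun
  Psi₂ : ZFun
  PsiAdj₁ : ZFun
  PsiAdj₂ : ZFun

namespace TodaObjects

/-- The operators have the Toda form, the Lax operators are dressed by the wave operators, and
the wave functions and adjoint wave functions are those of the wave operators
at `(x, y) = (t, -t)`. -/
structure HasTodaForm (𝒯 : TodaObjects) : Prop where
  S₁_form : ∀ j n : ℤ, 0 < j → 𝒯.S₁.coeff j n = 0
  S₁_lead : ∀ n : ℤ, 𝒯.S₁.coeff 0 n = 1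
  S₂_form : ∀ j n : ℤ, j < 0 → 𝒯.S₂.coeff j n = 0
  S₂_lead : ∀ n : ℤ, IsUnit (𝒯.S₂.coeff 0 n)
  L₁_form : ∀ j n : ℤ, 1 < j → 𝒯.L₁.coeff j n = 0
  L₁_lead : ∀ n : ℤ, 𝒯.L₁.coeff 1 n = 1
  L₂_form : ∀ j n : ℤ, j < -1 → 𝒯.L₂.coeff j n = 0
  L₂_lead : ∀ n : ℤ, IsUnit (𝒯.L₂.coeff (-1) n)
  L₁_dressing : 𝒯.L₁ = 𝒯.S₁ * PDO.shift 1 * PDO.invDown 𝒯.S₁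
  L₂_dressing : 𝒯.L₂ = 𝒯.S₂ * PDO.shift (-1) * PDO.invUp 𝒯.S₂
  Psi₁_eq : 𝒯.Psi₁ = act 𝒯.S₁ (expUp 1)
  Psi₂_eq : 𝒯.Psi₂ = act 𝒯.S₂ (expDown (-1))
  PsiAdj₁_eq : 𝒯.PsiAdj₁ = act (PDO.adj (PDO.invDown 𝒯.S₁)) (expDownNeg (-1))
  PsiAdj₂_eq : 𝒯.PsiAdj₂ = act (PDO.adj (PDO.invUp 𝒯.S₂)) (expUpNeg 1)

/-- The Toda bilinear equation
`∮_{z=∞} dz/(2πi z) Ψ₁(n;t,-t;z) Ψ₁^*(n';t',-t';z) = ∮_{z=0} dz/(2πi z) Ψ₂(n;t,-t;z) Ψ₂^*(n';t',-t';z)`,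
together with the fact that both residues are well defined. -/
def Bilinear (𝒯 : TodaObjects) : Prop :=
  ∀ (n n' : ℤ) (α β : ℕ+ →₀ ℕ),
    (Function.support (resTerm 𝒯.Psi₁ 𝒯.PsiAdj₁ n n' α β)).Finite ∧
    (Function.support (resTerm 𝒯.Psi₂ 𝒯.PsiAdj₂ n n' α β)).Finite ∧
    res 𝒯.Psi₁ 𝒯.PsiAdj₁ n n' α β = res 𝒯.Psi₂ 𝒯.PsiAdj₂ n n' α β

/-- The Toda evolution equations along `∂_{t_k} = ∂_{x_k} - ∂_{y_k}`, with
`ℬ_k = (ℒ₁^k)_{≥0} - (ℒ₂^k)_{<0}`. -/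
structure Evolution (𝒯 : TodaObjects) : Prop where
  lax₁ : ∀ k : ℕ+, PDO.pd k 𝒯.L₁ =
    PDO.comm (PDO.ge 0 (𝒯.L₁ ^ (k : ℕ)) - PDO.lt 0 (𝒯.L₂ ^ (k : ℕ))) 𝒯.L₁
  lax₂ : ∀ k : ℕ+, PDO.pd k 𝒯.L₂ =
    PDO.comm (PDO.ge 0 (𝒯.L₁ ^ (k : ℕ)) - PDO.lt 0 (𝒯.L₂ ^ (k : ℕ))) 𝒯.L₂
  wave₁ : ∀ k : ℕ+, PDO.pd k 𝒯.S₁ =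
    -((PDO.lt 0 (𝒯.L₁ ^ (k : ℕ)) + PDO.lt 0 (𝒯.L₂ ^ (k : ℕ))) * 𝒯.S₁)
  wave₂ : ∀ k : ℕ+, PDO.pd k 𝒯.S₂ =
    (PDO.ge 0 (𝒯.L₁ ^ (k : ℕ)) + PDO.ge 0 (𝒯.L₂ ^ (k : ℕ))) * 𝒯.S₂

/-- `Γ₁ = e^{-φ(n)} Λ`, where `e^{φ(n)}` is the coefficient of `Λ^0` in `𝒮₂`. -/
def gamma₁ (𝒯 : TodaObjects) : PDO :=
  PDO.ofFun (fun n => (𝒯.S₂.coeff 0 n)⁻¹) * PDO.shift 1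

end TodaObjects

/-! ### The two Miura transformations -/

/-- `T₁ = b_0(n)^{-1}`. -/
def miuraT₁ (Sp : PDO) : PDO := PDO.ofFun fun n => (b0 Sp n)⁻¹

/-- `T₁^{-1} = b_0(n)`. -/
def miuraT₁Inv (Sp : PDO) : PDO := PDO.ofFun fun n => b0 Sp n

/-- `T₂ = b_0(n+1)^{-1} Δ`. -/
def miuraT₂ (Sp : PDO) : PDO := PDO.ofFun (fun n => (b0 Sp (n + 1))⁻¹) * PDO.delta

/-- The image of the large BKP objects under `T₁`. -/
def miura₁ (Sp Sm : PDO) : TodaObjects where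
  S₁ := miuraT₁ Sp * Sp
  S₂ := miuraT₁ Sp * PDO.adj Sm
  L₁ := miuraT₁ Sp * laxPlus Sp * miuraT₁Inv Sp
  L₂ := miuraT₁ Sp * laxMinus Sm * miuraT₁Inv Sp
  Psi₁ := act (miuraT₁ Sp) (wavePlus Sp)
  Psi₂ := zmul (-1) (act (miuraT₁ Sp) (zinv (waveMinus Sm)))
  PsiAdj₁ := act (miuraT₁Inv Sp * (PDO.shift (-1) - PDO.shift 1)) (waveMinus Sm)
  PsiAdj₂ := -zmul 1
    (act (miuraT₁Inv Sp * (PDO.shift (-1) - PDO.shift 1)) (zinv (wavePlus Sp)))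

/-- The image of the large BKP objects under `T₂`. -/
def miura₂ (Sp Sm : PDO) : TodaObjects where
  S₁ := miuraT₂ Sp * Sp * PDO.shift (-1)
  S₂ := -(miuraT₂ Sp * PDO.adj Sm)
  L₁ := miuraT₂ Sp * laxPlus Sp * PDO.invDown (miuraT₂ Sp)
  L₂ := miuraT₂ Sp * laxMinus Sm * PDO.invUp (miuraT₂ Sp)
  Psi₁ := zmul (-1) (act (miuraT₂ Sp) (wavePlus Sp))
  Psi₂ := -zmul (-1) (act (miuraT₂ Sp) (zinv (waveMinus Sm)))
  PsiAdj₁ := zmul 1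
    (act (PDO.ofFun (fun n => b0 Sp (n + 1)) * (PDO.shift 1 + 1)) (waveMinus Sm))
  PsiAdj₂ := zmul 1
    (act (PDO.ofFun (fun n => b0 Sp (n + 1)) * (PDO.shift 1 + 1)) (zinv (wavePlus Sp)))

/-- The sub-Toda constraints attached to `T₁`:
`𝒮₁ Λ^{-1} 𝒮₂^* = T₁ (ι_{Λ^{-1}}(Λ-Λ^{-1})^{-1}) T₁^*` and
`ℒ₁^* (Γ₁ - Γ₁^*) = (Γ₁ - Γ₁^*) ℒ₂`. -/
structure Constraint₁ (T₁ : PDO) (𝒯 : TodaObjects) : Prop where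
  wave : 𝒯.S₁ * PDO.shift (-1) * PDO.adj 𝒯.S₂ =
    T₁ * PDO.invDown PDO.lamSub * PDO.adj T₁
  lax : PDO.adj 𝒯.L₁ * (𝒯.gamma₁ - PDO.adj 𝒯.gamma₁) =
    (𝒯.gamma₁ - PDO.adj 𝒯.gamma₁) * 𝒯.L₂

/-- The sub-Toda constraints attached to `T₂`:
`𝒮₁ 𝒮₂^* = -T₂ (ι_{Λ^{-1}}(Λ-Λ^{-1})^{-1}) T₂^*` and
`T₂ ι_Λ(Λ-Λ^{-1})^{-1} T₂^* ℒ₁^* = ℒ₂ T₂ ι_Λ(Λ-Λ^{-1})^{-1} T₂^*`. -/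
structure Constraint₂ (T₂ : PDO) (𝒯 : TodaObjects) : Prop where
  wave : 𝒯.S₁ * PDO.adj 𝒯.S₂ = -(T₂ * PDO.invDown PDO.lamSub * PDO.adj T₂)
  lax : T₂ * PDO.invUp PDO.lamSub * PDO.adj T₂ * PDO.adj 𝒯.L₁ =
    𝒯.L₂ * T₂ * PDO.invUp PDO.lamSub * PDO.adj T₂

end LargeBKP

end

/-!
# Miura transformations from the large BKP hierarchy to the Toda hierarchy

Operators bounded above in powers of `Λ` form a ring (`DownOp`), so do those bounded below (`UpOp`),
and the adjoint exchanges the two.  Every product in the statement lives in one of these rings;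
the passage between them goes through the difference operators (`IsBanded`), which lie in both.

*Inverses.*  The leading term of `S⁺Λ⁻¹S⁻ = ι(Λ - Λ⁻¹)⁻¹` reads `b₀(n+1) \bar b₀(n) = 1`, where
`\bar b₀` is the coefficient of `Λ⁰` in `S⁻`; so `b₀` is invertible, and the constraint itself gives `(S⁺)⁻¹ = Λ⁻¹S⁻(Λ - Λ⁻¹)` and
`(S⁻)⁻¹ = (Λ - Λ⁻¹)S⁺Λ⁻¹` (`IsWavePair.inv_plus`, `IsWavePair.inv_minus`).  These two formulas
identify the adjoint wave functions and yield the constraints on the Toda side.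

*Evolution.*  `S⁺` and `(S⁻)^*` evolve under the same difference operator `B_k`.  A gauge
transformation `T` preserves this as soon as `(T B_k + ∂T) T⁻¹` is again a difference operator; this
is clear for `T₁`, and for `T₂` it holds because `B_k` is right divisible by `Λ - Λ⁻¹`, hence by `Δ`
(`exists_gauge_miuraT₂`).  The images therefore satisfy `∂𝒮₁ = M 𝒮₁ - 𝒮₁Λ^k` and
`∂𝒮₂ = M 𝒮₂ + 𝒮₂Λ^{-k}` with one difference operator `M` (`TodaFlow`).  The normalisation of `𝒮₁`
makes `M - ℒ₁^k = (∂𝒮₁)𝒮₁⁻¹` contain only negative powers of `Λ`, while `M + ℒ₂^k = (∂𝒮₂)𝒮₂⁻¹`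
contains only nonnegative ones, so that `M = (ℒ₁^k)_{≥0} - (ℒ₂^k)_{<0}` is forced (`flow_eq`),
and all evolution equations follow.

*Bilinear equation.*  For `i = 1, 2` one has `∂Ψᵢ = M Ψᵢ` and `∂Ψᵢ^* = -M^* Ψᵢ^*`, so the two
residues, as functions of `(n, t, n', t')`, satisfy the same linear equations.  At `t = t' = 0` they
are the entries of `𝒮₁𝒮₁⁻¹ = 1` and `𝒮₂𝒮₂⁻¹ = 1` (`res_zero_zero`).  Hence all their Taylor
coefficients agree (`res_eq_of_flow`).
-/

noncomputable section

namespace LargeBKP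

namespace PDO

/-! ### Linear structure and formal adjoint -/

@[simp] theorem coeff_zero (j n : ℤ) : (0 : PDO).coeff j n = 0 := rfl
@[simp] theorem coeff_add (A B : PDO) (j n : ℤ) :
    (A + B).coeff j n = A.coeff j n + B.coeff j n := rfl
@[simp] theorem coeff_neg (A : PDO) (j n : ℤ) : (-A).coeff j n = -A.coeff j n := rfl
@[simp] theorem coeff_sub (A B : PDO) (j n : ℤ) :
    (A - B).coeff j n = A.coeff j n - B.coeff j n := rfl
@[simp] theorem coeff_adj (A : PDO) (j n : ℤ) : A.adj.coeff j n = A.coeff (-j) (n + j) := rfl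
@[simp] theorem coeff_pd (k : ℕ+) (A : PDO) (j n : ℤ) :
    (pd k A).coeff j n = MvPowerSeries.pderiv ℂ k (A.coeff j n) := rfl
theorem coeff_shift (k j n : ℤ) : (shift k).coeff j n = if j = k then 1 else 0 := rfl
theorem coeff_one (j n : ℤ) : (1 : PDO).coeff j n = if j = 0 then 1 else 0 := rfl
theorem coeff_ofFun (f : ℤ → TimeSeries) (j n : ℤ) :
    (ofFun f).coeff j n = if j = 0 then f n else 0 := rfl
theorem coeff_mul (A B : PDO) (j n : ℤ) :
    (A * B).coeff j n = ∑ᶠ i : ℤ, A.coeff i n * B.coeff (j - i) (n + i) := rfl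
theorem coeff_ge (m : ℤ) (A : PDO) (j n : ℤ) :
    (ge m A).coeff j n = if m ≤ j then A.coeff j n else 0 := rfl
theorem coeff_lt (m : ℤ) (A : PDO) (j n : ℤ) :
    (lt m A).coeff j n = if j < m then A.coeff j n else 0 := rfl

instance : AddCommGroup PDO where
  add_assoc A B C := by ext1; funext j n; simp [add_assoc]
  zero_add A := by ext1; funext j n; simp
  add_zero A := by ext1; funext j n; simp
  add_comm A B := by ext1; funext j n; simp [add_comm]
  neg_add_cancel A := by ext1; funext j n; simp
  sub_eq_add_neg A B := by ext1; funext j n; simp [sub_eq_add_neg]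
  nsmul := nsmulRec
  zsmul := zsmulRec

theorem shift_zero : shift 0 = 1 := rfl

@[simp] theorem adj_adj (A : PDO) : A.adj.adj = A := by
  ext1; funext j n; simp
@[simp] theorem adj_add (A B : PDO) : (A + B).adj = A.adj + B.adj := rfl
@[simp] theorem adj_neg (A : PDO) : (-A).adj = -A.adj := rfl
@[simp] theorem adj_sub (A B : PDO) : (A - B).adj = A.adj - B.adj := rfl
@[simp] theorem adj_shift (k : ℤ) : (shift k).adj = shift (-k) := by
  ext1; funext j n; simp only [coeff_adj, coeff_shift, neg_eq_iff_eq_neg]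
@[simp] theorem adj_one : (1 : PDO).adj = 1 := by
  rw [← shift_zero, adj_shift, neg_zero]
@[simp] theorem adj_ofFun (f : ℤ → TimeSeries) : (ofFun f).adj = ofFun f := by
  ext1; funext j n
  simp only [coeff_adj, coeff_ofFun, neg_eq_zero]
  split_ifs with h <;> simp [h]

/-- The adjoint reverses products; no finiteness is needed because both sides are the same
family of terms, reindexed. -/
@[simp] theorem adj_mul (A B : PDO) : (A * B).adj = B.adj * A.adj := by
  ext1; funext j n
  simp only [coeff_adj, coeff_mul]
  rw [← finsum_comp_equiv (Equiv.addRight (-j))]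
  refine finsum_congr fun i => ?_
  rw [mul_comm]
  simp only [Equiv.coe_addRight]
  congr 2 <;> ring

theorem adj_injective : Function.Injective adj :=
  Function.LeftInverse.injective (g := adj) adj_adj

@[simp] theorem adj_pd (k : ℕ+) (A : PDO) : (pd k A).adj = pd k A.adj := rfl

/-! ### Orders -/

/-- `A` has order at most `N`: `A = ∑_{j ≤ N} a_j Λ^j`. -/
def OrderLE (N : ℤ) (A : PDO) : Prop := ∀ j n : ℤ, N < j → A.coeff j n = 0

/-- `A` has only powers at least `N`: `A = ∑_{j ≥ N} a_j Λ^j`. -/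
def OrderGE (N : ℤ) (A : PDO) : Prop := ∀ j n : ℤ, j < N → A.coeff j n = 0

theorem OrderLE.isDown {N : ℤ} {A : PDO} (h : OrderLE N A) : A.IsDown := ⟨N, h⟩
theorem OrderGE.isUp {N : ℤ} {A : PDO} (h : OrderGE N A) : A.IsUp := ⟨N, h⟩

theorem OrderLE.mono {N M : ℤ} {A : PDO} (h : OrderLE N A) (hNM : N ≤ M) : OrderLE M A :=
  fun j n hj => h j n (by lia)

theorem OrderLE.adj {N : ℤ} {A : PDO} (h : OrderLE N A) : OrderGE (-N) A.adj :=
  fun j n hj => h _ _ (by lia)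
theorem OrderGE.adj {N : ℤ} {A : PDO} (h : OrderGE N A) : OrderLE (-N) A.adj :=
  fun j n hj => h _ _ (by lia)

theorem OrderLE.add {N : ℤ} {A B : PDO} (hA : OrderLE N A) (hB : OrderLE N B) :
    OrderLE N (A + B) := fun j n hj => by simp [hA j n hj, hB j n hj]
theorem OrderLE.neg {N : ℤ} {A : PDO} (hA : OrderLE N A) : OrderLE N (-A) :=
  fun j n hj => by simp [hA j n hj]

theorem orderLE_shift (k : ℤ) : OrderLE k (shift k) :=
  fun j n hj => by rw [coeff_shift, if_neg (by lia)]
theorem orderGE_shift (k : ℤ) : OrderGE k (shift k) :=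
  fun j n hj => by rw [coeff_shift, if_neg (by lia)]
theorem orderLE_ofFun (f : ℤ → TimeSeries) : OrderLE 0 (ofFun f) :=
  fun j n hj => by rw [coeff_ofFun, if_neg (by lia)]
theorem orderGE_ofFun (f : ℤ → TimeSeries) : OrderGE 0 (ofFun f) :=
  fun j n hj => by rw [coeff_ofFun, if_neg (by lia)]

theorem IsDown.adj {A : PDO} (h : A.IsDown) : A.adj.IsUp :=
  let ⟨_, h⟩ := h; (OrderLE.adj h).isUp
theorem IsUp.adj {A : PDO} (h : A.IsUp) : A.adj.IsDown :=
  let ⟨_, h⟩ := h; (OrderGE.adj h).isDown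

theorem isDown_shift (k : ℤ) : (shift k).IsDown := (orderLE_shift k).isDown
theorem isUp_shift (k : ℤ) : (shift k).IsUp := (orderGE_shift k).isUp
theorem isDown_ofFun (f : ℤ → TimeSeries) : (ofFun f).IsDown := (orderLE_ofFun f).isDown
theorem isUp_ofFun (f : ℤ → TimeSeries) : (ofFun f).IsUp := (orderGE_ofFun f).isUp

theorem IsDown.add {A B : PDO} (hA : A.IsDown) (hB : B.IsDown) : (A + B).IsDown := by
  obtain ⟨a, hA⟩ := hA
  obtain ⟨b, hB⟩ := hB
  exact ((OrderLE.mono hA (le_max_left a b)).add (OrderLE.mono hB (le_max_right a b))).isDown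
theorem IsDown.neg {A : PDO} (hA : A.IsDown) : (-A).IsDown :=
  let ⟨_, h⟩ := hA; (OrderLE.neg h).isDown
theorem IsDown.pd {A : PDO} (k : ℕ+) (hA : A.IsDown) : (pd k A).IsDown :=
  let ⟨N, h⟩ := hA; ⟨N, fun j n hj => by simp [h j n hj]⟩
theorem IsUp.pd {A : PDO} (k : ℕ+) (hA : A.IsUp) : (PDO.pd k A).IsUp :=
  let ⟨N, h⟩ := hA; ⟨N, fun j n hj => by simp [h j n hj]⟩

/-- For factors expanded in powers of `Λ⁻¹` the product is a finite sum, which may be taken over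
any interval that is large enough. -/
theorem OrderLE.coeff_mul {a b : ℤ} {A B : PDO} (hA : OrderLE a A) (hB : OrderLE b B)
    {j l u : ℤ} (n : ℤ) (hl : l ≤ j - b) (hu : a ≤ u) :
    (A * B).coeff j n = ∑ i ∈ Finset.Icc l u, A.coeff i n * B.coeff (j - i) (n + i) := by
  rw [PDO.coeff_mul]
  refine finsum_eq_sum_of_support_subset _ fun i hi => ?_
  by_contra h
  rw [Finset.coe_Icc, Set.mem_Icc, not_and_or, not_le, not_le] at h
  refine hi ?_
  rcases h with h | h
  · exact mul_eq_zero_of_right _ (hB _ _ (by lia))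
  · exact mul_eq_zero_of_left (hA _ _ (by lia)) _

theorem OrderLE.mul {a b : ℤ} {A B : PDO} (hA : OrderLE a A) (hB : OrderLE b B) :
    OrderLE (a + b) (A * B) := fun j n hj => by
  rw [hA.coeff_mul hB n le_rfl le_rfl, Finset.Icc_eq_empty (by lia), Finset.sum_empty]

theorem OrderLE.coeff_mul_lead {a b : ℤ} {A B : PDO} (hA : OrderLE a A) (hB : OrderLE b B)
    (n : ℤ) : (A * B).coeff (a + b) n = A.coeff a n * B.coeff b (n + a) := by
  rw [hA.coeff_mul hB n (l := a) (u := a) (by lia) le_rfl, Finset.Icc_self, Finset.sum_singleton,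
    add_sub_cancel_left]

theorem IsDown.mul {A B : PDO} (hA : A.IsDown) (hB : B.IsDown) : (A * B).IsDown :=
  let ⟨_, hA⟩ := hA; let ⟨_, hB⟩ := hB; (OrderLE.mul hA hB).isDown

theorem IsDown.mul_assoc {A B C : PDO} (hA : A.IsDown) (hB : B.IsDown) (hC : C.IsDown) :
    A * B * C = A * (B * C) := by
  obtain ⟨a, hA : OrderLE a A⟩ := hA
  obtain ⟨b, hB : OrderLE b B⟩ := hB
  obtain ⟨c, hC : OrderLE c C⟩ := hC
  ext1; funext j n
  rw [(hA.mul hB).coeff_mul hC n le_rfl le_rfl,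
    hA.coeff_mul (hB.mul hC) n (l := j - c - b) (by lia) le_rfl]
  have h₁ : ∀ i ∈ Finset.Icc (j - c) (a + b), (A * B).coeff i n * C.coeff (j - i) (n + i) =
      ∑ l ∈ Finset.Icc (j - c - b) a,
        A.coeff l n * B.coeff (i - l) (n + l) * C.coeff (j - i) (n + i) := fun i hi => by
    rw [Finset.mem_Icc] at hi
    rw [hA.coeff_mul hB n (l := j - c - b) (by lia) le_rfl, Finset.sum_mul]
  rw [Finset.sum_congr rfl h₁, Finset.sum_comm]
  refine Finset.sum_congr rfl fun l hl => ?_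
  rw [Finset.mem_Icc] at hl
  rw [hB.coeff_mul hC (n + l) (l := j - c - l) (u := a + b - l) (by lia) (by lia),
    Finset.mul_sum]
  refine Finset.sum_bij' (fun i _ => i - l) (fun i _ => i + l) ?_ ?_ ?_ ?_ ?_
  · intro i hi; rw [Finset.mem_Icc] at hi ⊢; lia
  · intro i hi; rw [Finset.mem_Icc] at hi ⊢; lia
  · intro i _; ring
  · intro i _; ring
  · intro i _
    rw [_root_.mul_assoc, show j - l - (i - l) = j - i by ring,
      show n + l + (i - l) = n + i by ring]

theorem IsDown.add_mul {A B C : PDO} (hA : A.IsDown) (hB : B.IsDown) (hC : C.IsDown) :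
    (A + B) * C = A * C + B * C := by
  obtain ⟨a, hA : OrderLE a A⟩ := hA
  obtain ⟨b, hB : OrderLE b B⟩ := hB
  obtain ⟨c, hC : OrderLE c C⟩ := hC
  ext1; funext j n
  have hA' := hA.mono (le_max_left a b)
  have hB' := hB.mono (le_max_right a b)
  rw [coeff_add, (hA'.add hB').coeff_mul hC n le_rfl le_rfl, hA'.coeff_mul hC n le_rfl le_rfl,
    hB'.coeff_mul hC n le_rfl le_rfl, ← Finset.sum_add_distrib]
  exact Finset.sum_congr rfl fun i _ => by rw [coeff_add, _root_.add_mul]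

theorem IsDown.mul_add {A B C : PDO} (hA : A.IsDown) (hB : B.IsDown) (hC : C.IsDown) :
    A * (B + C) = A * B + A * C := by
  obtain ⟨a, hA : OrderLE a A⟩ := hA
  obtain ⟨b, hB : OrderLE b B⟩ := hB
  obtain ⟨c, hC : OrderLE c C⟩ := hC
  ext1; funext j n
  have hB' := hB.mono (le_max_left b c)
  have hC' := hC.mono (le_max_right b c)
  rw [coeff_add, hA.coeff_mul (hB'.add hC') n le_rfl le_rfl, hA.coeff_mul hB' n le_rfl le_rfl,
    hA.coeff_mul hC' n le_rfl le_rfl, ← Finset.sum_add_distrib]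
  exact Finset.sum_congr rfl fun i _ => by rw [coeff_add, _root_.mul_add]

theorem coeff_shift_mul (k : ℤ) (A : PDO) (j n : ℤ) :
    (shift k * A).coeff j n = A.coeff (j - k) (n + k) := by
  rw [coeff_mul, finsum_eq_single _ k fun i hi => by rw [coeff_shift, if_neg hi, zero_mul],
    coeff_shift, if_pos rfl, one_mul]

theorem coeff_mul_shift (A : PDO) (k j n : ℤ) :
    (A * shift k).coeff j n = A.coeff (j - k) n := by
  rw [coeff_mul, finsum_eq_single _ (j - k) fun i hi => by
      rw [coeff_shift, if_neg (by lia), mul_zero],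
    coeff_shift, if_pos (by ring), mul_one]

theorem coeff_ofFun_mul (f : ℤ → TimeSeries) (A : PDO) (j n : ℤ) :
    (ofFun f * A).coeff j n = f n * A.coeff j n := by
  rw [coeff_mul, finsum_eq_single _ 0 fun i hi => by rw [coeff_ofFun, if_neg hi, zero_mul],
    coeff_ofFun, if_pos rfl, sub_zero, add_zero]

theorem coeff_mul_ofFun (A : PDO) (f : ℤ → TimeSeries) (j n : ℤ) :
    (A * ofFun f).coeff j n = A.coeff j n * f (n + j) := by
  rw [coeff_mul, finsum_eq_single _ j fun i hi => by
      rw [coeff_ofFun, if_neg (by lia), mul_zero],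
    coeff_ofFun, if_pos (sub_self j)]

protected theorem one_mul (A : PDO) : 1 * A = A := by
  ext1; funext j n; rw [← shift_zero, coeff_shift_mul, sub_zero, add_zero]
protected theorem mul_one (A : PDO) : A * 1 = A := by
  ext1; funext j n; rw [← shift_zero, coeff_mul_shift, sub_zero]
protected theorem zero_mul (A : PDO) : 0 * A = 0 := by
  ext1; funext j n; rw [coeff_mul]; simp
protected theorem mul_zero (A : PDO) : A * 0 = 0 := by
  ext1; funext j n; rw [coeff_mul]; simp

theorem shift_mul_shift (k l : ℤ) : shift k * shift l = shift (k + l) := by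
  ext1; funext j n
  rw [coeff_shift_mul, coeff_shift, coeff_shift]
  exact if_congr (by lia) rfl rfl

theorem ofFun_mul_ofFun (f g : ℤ → TimeSeries) :
    ofFun f * ofFun g = ofFun fun n => f n * g n := by
  ext1; funext j n
  rw [coeff_ofFun_mul, coeff_ofFun, coeff_ofFun, mul_ite, mul_zero]

theorem ofFun_one : ofFun (fun _ => 1) = 1 := rfl

theorem pd_mul_of_isDown (k : ℕ+) {A B : PDO} (hA : A.IsDown) (hB : B.IsDown) :
    pd k (A * B) = pd k A * B + A * pd k B := by
  obtain ⟨a, hA : OrderLE a A⟩ := hA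
  obtain ⟨b, hB : OrderLE b B⟩ := hB
  have hA' : OrderLE a (pd k A) := fun j n hj => by simp [hA j n hj]
  have hB' : OrderLE b (pd k B) := fun j n hj => by simp [hB j n hj]
  ext1; funext j n
  rw [coeff_pd, coeff_add, hA.coeff_mul hB n le_rfl le_rfl, hA'.coeff_mul hB n le_rfl le_rfl,
    hA.coeff_mul hB' n le_rfl le_rfl, map_sum, ← Finset.sum_add_distrib]
  refine Finset.sum_congr rfl fun i _ => ?_
  rw [Derivation.leibniz, smul_eq_mul, smul_eq_mul, coeff_pd, coeff_pd]
  ring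

@[simp] theorem pd_shift (k : ℕ+) (m : ℤ) : pd k (shift m) = 0 := by
  ext1; funext j n
  rw [coeff_pd, coeff_shift, coeff_zero]
  split_ifs
  · exact MvPowerSeries.pderiv_one
  · exact map_zero _
@[simp] theorem pd_one (k : ℕ+) : pd k (1 : PDO) = 0 := pd_shift k 0
theorem pd_sub (k : ℕ+) (A B : PDO) : pd k (A - B) = pd k A - pd k B := by
  ext1; funext j n; simp
theorem pd_neg (k : ℕ+) (A : PDO) : pd k (-A) = -pd k A := by
  ext1; funext j n; simp

theorem OrderGE.mul {a b : ℤ} {A B : PDO} (hA : OrderGE a A) (hB : OrderGE b B) :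
    OrderGE (a + b) (A * B) := by
  simpa using (hB.adj.mul hA.adj).adj

theorem OrderGE.coeff_mul_lead {a b : ℤ} {A B : PDO} (hA : OrderGE a A) (hB : OrderGE b B)
    (n : ℤ) : (A * B).coeff (a + b) n = A.coeff a n * B.coeff b (n + a) := by
  have h := hB.adj.coeff_mul_lead hA.adj (n + a + b)
  rw [← adj_mul] at h
  simp only [coeff_adj, neg_add_rev, neg_neg, add_neg_cancel_right] at h
  rw [show n + a + b + (-b + -a) = n by ring] at h
  rw [h, mul_comm]

end PDO

/-! ### The rings of one-sided operators -/

/-- The ring of operators expanded in powers of `Λ⁻¹`. -/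
@[ext]
structure DownOp : Type where
  val : PDO
  prop : val.IsDown

/-- The ring of operators expanded in powers of `Λ`. -/
@[ext]
structure UpOp : Type where
  val : PDO
  prop : val.IsUp

open PDO

instance : Zero DownOp := ⟨⟨0, ⟨0, fun _ _ _ => rfl⟩⟩⟩
instance : One DownOp := ⟨⟨1, isDown_shift 0⟩⟩
instance : Add DownOp := ⟨fun A B => ⟨A.1 + B.1, A.2.add B.2⟩⟩
instance : Neg DownOp := ⟨fun A => ⟨-A.1, A.2.neg⟩⟩
instance : Sub DownOp :=
  ⟨fun A B => ⟨A.1 - B.1, by rw [sub_eq_add_neg]; exact A.2.add B.2.neg⟩⟩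
instance : Mul DownOp := ⟨fun A B => ⟨A.1 * B.1, A.2.mul B.2⟩⟩

instance : Ring DownOp where
  add_assoc A B C := DownOp.ext (add_assoc A.1 B.1 C.1)
  zero_add A := DownOp.ext (zero_add A.1)
  add_zero A := DownOp.ext (add_zero A.1)
  add_comm A B := DownOp.ext (add_comm A.1 B.1)
  neg_add_cancel A := DownOp.ext (neg_add_cancel A.1)
  sub_eq_add_neg A B := DownOp.ext (sub_eq_add_neg A.1 B.1)
  mul_assoc A B C := DownOp.ext (IsDown.mul_assoc A.2 B.2 C.2)
  one_mul A := DownOp.ext (PDO.one_mul A.1)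
  mul_one A := DownOp.ext (PDO.mul_one A.1)
  zero_mul A := DownOp.ext (PDO.zero_mul A.1)
  mul_zero A := DownOp.ext (PDO.mul_zero A.1)
  left_distrib A B C := DownOp.ext (IsDown.mul_add A.2 B.2 C.2)
  right_distrib A B C := DownOp.ext (IsDown.add_mul A.2 B.2 C.2)
  nsmul := nsmulRec
  zsmul := zsmulRec

namespace PDO

theorem IsUp.add {A B : PDO} (hA : A.IsUp) (hB : B.IsUp) : (A + B).IsUp := by
  simpa using (hA.adj.add hB.adj).adj
theorem IsUp.neg {A : PDO} (hA : A.IsUp) : (-A).IsUp := by simpa using hA.adj.neg.adj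
theorem IsUp.mul {A B : PDO} (hA : A.IsUp) (hB : B.IsUp) : (A * B).IsUp := by
  simpa using (hB.adj.mul hA.adj).adj
theorem IsUp.mul_assoc {A B C : PDO} (hA : A.IsUp) (hB : B.IsUp) (hC : C.IsUp) :
    A * B * C = A * (B * C) :=
  adj_injective (by simpa using (IsDown.mul_assoc hC.adj hB.adj hA.adj).symm)
theorem IsUp.add_mul {A B C : PDO} (hA : A.IsUp) (hB : B.IsUp) (hC : C.IsUp) :
    (A + B) * C = A * C + B * C :=
  adj_injective (by simpa using IsDown.mul_add hC.adj hA.adj hB.adj)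
theorem IsUp.mul_add {A B C : PDO} (hA : A.IsUp) (hB : B.IsUp) (hC : C.IsUp) :
    A * (B + C) = A * B + A * C :=
  adj_injective (by simpa using IsDown.add_mul hB.adj hC.adj hA.adj)
theorem pd_mul_of_isUp (k : ℕ+) {A B : PDO} (hA : A.IsUp) (hB : B.IsUp) :
    pd k (A * B) = pd k A * B + A * pd k B :=
  adj_injective (by simpa [add_comm] using pd_mul_of_isDown k hB.adj hA.adj)

end PDO

instance : Zero UpOp := ⟨⟨0, ⟨0, fun _ _ _ => rfl⟩⟩⟩
instance : One UpOp := ⟨⟨1, isUp_shift 0⟩⟩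
instance : Add UpOp := ⟨fun A B => ⟨A.1 + B.1, A.2.add B.2⟩⟩
instance : Neg UpOp := ⟨fun A => ⟨-A.1, A.2.neg⟩⟩
instance : Sub UpOp :=
  ⟨fun A B => ⟨A.1 - B.1, by rw [sub_eq_add_neg]; exact A.2.add B.2.neg⟩⟩
instance : Mul UpOp := ⟨fun A B => ⟨A.1 * B.1, A.2.mul B.2⟩⟩

instance : Ring UpOp where
  add_assoc A B C := UpOp.ext (add_assoc A.1 B.1 C.1)
  zero_add A := UpOp.ext (zero_add A.1)
  add_zero A := UpOp.ext (add_zero A.1)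
  add_comm A B := UpOp.ext (add_comm A.1 B.1)
  neg_add_cancel A := UpOp.ext (neg_add_cancel A.1)
  sub_eq_add_neg A B := UpOp.ext (sub_eq_add_neg A.1 B.1)
  mul_assoc A B C := UpOp.ext (IsUp.mul_assoc A.2 B.2 C.2)
  one_mul A := UpOp.ext (PDO.one_mul A.1)
  mul_one A := UpOp.ext (PDO.mul_one A.1)
  zero_mul A := UpOp.ext (PDO.zero_mul A.1)
  mul_zero A := UpOp.ext (PDO.mul_zero A.1)
  left_distrib A B C := UpOp.ext (IsUp.mul_add A.2 B.2 C.2)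
  right_distrib A B C := UpOp.ext (IsUp.add_mul A.2 B.2 C.2)
  nsmul := nsmulRec
  zsmul := zsmulRec

theorem DownOp.val_pow (A : DownOp) (k : ℕ) : (A ^ k).1 = A.1 ^ k := by
  induction k with
  | zero => rfl
  | succ k ih =>
    rw [pow_succ]
    exact congrArg (· * A.1) ih

theorem UpOp.val_pow (A : UpOp) (k : ℕ) : (A ^ k).1 = A.1 ^ k := by
  induction k with
  | zero => rfl
  | succ k ih =>
    rw [pow_succ]
    exact congrArg (· * A.1) ih

namespace PDO

/-! ### Leading coefficients and inverses -/

/-- Left multiplication by an operator with invertible leading coefficient cannot lower the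
order. -/
theorem OrderLE.of_unit_mul {S Y : PDO} (hS : OrderLE 0 S) (hu : ∀ n, IsUnit (S.coeff 0 n))
    (hY : Y.IsDown) {m : ℤ} (h : OrderLE m (S * Y)) : OrderLE m Y := by
  obtain ⟨N, hY : OrderLE N Y⟩ := hY
  -- lower the bound on the order of `Y` one step at a time
  have key : ∀ d : ℕ, ∀ M : ℤ, M = m + d → OrderLE M Y → OrderLE m Y := by
    intro d
    induction d with
    | zero => intro M hM hY; simpa [hM] using hY
    | succ d ih =>
      intro M hM hY
      refine ih (M - 1) (by push_cast at hM; lia) fun j n hj => ?_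
      rcases eq_or_lt_of_le (show M ≤ j by lia) with rfl | hj'
      · have h0 := hS.coeff_mul_lead hY n
        rw [zero_add, add_zero, h _ _ (by push_cast at hM; lia)] at h0
        exact ((hu n).mul_right_eq_zero).1 h0.symm
      · exact hY _ _ hj'
  rcases le_total N m with hN | hN
  · exact hY.mono hN
  · exact key (N - m).toNat N (by lia) hY

theorem eq_zero_of_unit_mul_eq_zero {S Y : PDO} (hS : OrderLE 0 S)
    (hu : ∀ n, IsUnit (S.coeff 0 n)) (hY : Y.IsDown) (h : S * Y = 0) : Y = 0 := by
  ext1; funext j n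
  exact OrderLE.of_unit_mul hS hu hY (m := j - 1) (by rw [h]; exact fun _ _ _ => rfl) j n (by lia)

/-- `C` is a two-sided inverse of `A` among the operators in powers of `Λ⁻¹`. -/
structure IsDownInv (A C : PDO) : Prop where
  left_isDown : A.IsDown
  right_isDown : C.IsDown
  mul_eq_one : A * C = 1
  eq_one_mul : C * A = 1

/-- `C` is a two-sided inverse of `A` among the operators in powers of `Λ`. -/
structure IsUpInv (A C : PDO) : Prop where
  left_isUp : A.IsUp
  right_isUp : C.IsUp
  mul_eq_one : A * C = 1
  eq_one_mul : C * A = 1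

theorem IsUpInv.symm {A C : PDO} (h : IsUpInv A C) : IsUpInv C A :=
  ⟨h.2, h.1, h.4, h.3⟩
theorem IsDownInv.adj {A C : PDO} (h : IsDownInv A C) : IsUpInv A.adj C.adj :=
  ⟨h.1.adj, h.2.adj, by rw [← adj_mul, h.4, adj_one], by rw [← adj_mul, h.3, adj_one]⟩
theorem IsUpInv.adj {A C : PDO} (h : IsUpInv A C) : IsDownInv A.adj C.adj :=
  ⟨h.1.adj, h.2.adj, by rw [← adj_mul, h.4, adj_one], by rw [← adj_mul, h.3, adj_one]⟩

theorem IsDownInv.mul {A C B D : PDO} (h : IsDownInv A C) (h' : IsDownInv B D) :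
    IsDownInv (A * B) (D * C) := by
  refine ⟨h.1.mul h'.1, h'.2.mul h.2, ?_, ?_⟩
  · rw [IsDown.mul_assoc h.1 h'.1 (h'.2.mul h.2), ← IsDown.mul_assoc h'.1 h'.2 h.2, h'.3,
      PDO.one_mul, h.3]
  · rw [IsDown.mul_assoc h'.2 h.2 (h.1.mul h'.1), ← IsDown.mul_assoc h.2 h.1 h'.1, h.4,
      PDO.one_mul, h'.4]

theorem IsUpInv.mul {A C B D : PDO} (h : IsUpInv A C) (h' : IsUpInv B D) :
    IsUpInv (A * B) (D * C) := by
  simpa using (h'.adj.mul h.adj).adj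

theorem IsDownInv.neg {A C : PDO} (h : IsDownInv A C) : IsDownInv (-A) (-C) := by
  let a : DownOp := ⟨A, h.1⟩
  let c : DownOp := ⟨C, h.2⟩
  exact ⟨h.1.neg, h.2.neg,
    (congrArg DownOp.val (neg_mul_neg a c)).trans h.3,
    (congrArg DownOp.val (neg_mul_neg c a)).trans h.4⟩

theorem IsUpInv.neg {A C : PDO} (h : IsUpInv A C) : IsUpInv (-A) (-C) := by
  simpa using h.adj.neg.adj

theorem IsDownInv.invDown_eq {A C : PDO} (h : IsDownInv A C) : invDown A = C := by
  have hex : ∃ C : PDO, C.IsDown ∧ A * C = 1 ∧ C * A = 1 := ⟨C, h.2, h.3, h.4⟩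
  rw [invDown, dif_pos hex]
  obtain ⟨h₁, -, h₃⟩ := hex.choose_spec
  exact congrArg DownOp.val (left_inv_eq_right_inv (M := DownOp) (a := ⟨A, h.1⟩)
    (b := ⟨_, h₁⟩) (c := ⟨C, h.2⟩) (DownOp.ext h₃) (DownOp.ext h.3))

theorem IsUpInv.invUp_eq {A C : PDO} (h : IsUpInv A C) : invUp A = C := by
  have hex : ∃ C : PDO, C.IsUp ∧ A * C = 1 ∧ C * A = 1 := ⟨C, h.2, h.3, h.4⟩
  rw [invUp, dif_pos hex]
  obtain ⟨h₁, -, h₃⟩ := hex.choose_spec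
  exact congrArg UpOp.val (left_inv_eq_right_inv (M := UpOp) (a := ⟨A, h.1⟩)
    (b := ⟨_, h₁⟩) (c := ⟨C, h.2⟩) (UpOp.ext h₃) (UpOp.ext h.3))

/-- A right inverse of an operator with invertible leading coefficient is two-sided, because such
an operator can be cancelled on the left. -/
theorem isDownInv_of_mul_eq_one {S C : PDO} (hS : OrderLE 0 S)
    (hu : ∀ n, IsUnit (S.coeff 0 n)) (hC : C.IsDown) (h : S * C = 1) : IsDownInv S C := by
  refine ⟨hS.isDown, hC, h, ?_⟩
  let s : DownOp := ⟨S, hS.isDown⟩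
  let c : DownOp := ⟨C, hC⟩
  have hsc : s * c = 1 := DownOp.ext h
  have h0 : s * (c * s - 1) = 0 := by rw [mul_sub, ← mul_assoc, hsc, one_mul, mul_one, sub_self]
  have h1 : (c * s - 1).1 = 0 :=
    eq_zero_of_unit_mul_eq_zero hS hu (c * s - 1).2 (congrArg DownOp.val h0)
  exact sub_eq_zero.1 h1

theorem OrderLE.of_isDownInv {S C : PDO} (hS : OrderLE 0 S) (hu : ∀ n, IsUnit (S.coeff 0 n))
    (h : IsDownInv S C) : OrderLE 0 C :=
  OrderLE.of_unit_mul hS hu h.2 (by rw [h.3]; exact orderLE_shift 0)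

theorem OrderGE.of_isUpInv {S C : PDO} (hS : OrderGE 0 S) (hu : ∀ n, IsUnit (S.coeff 0 n))
    (h : IsUpInv S C) : OrderGE 0 C := by
  have h₀ : OrderLE 0 C.adj :=
    OrderLE.of_isDownInv (S := S.adj) hS.adj (fun n => by simpa using hu n) h.adj
  simpa using h₀.adj

theorem isDownInv_shift (k : ℤ) : IsDownInv (shift k) (shift (-k)) :=
  ⟨isDown_shift k, isDown_shift _, by rw [shift_mul_shift, add_neg_cancel, shift_zero],
    by rw [shift_mul_shift, neg_add_cancel, shift_zero]⟩
theorem isUpInv_shift (k : ℤ) : IsUpInv (shift k) (shift (-k)) :=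
  ⟨isUp_shift k, isUp_shift _, by rw [shift_mul_shift, add_neg_cancel, shift_zero],
    by rw [shift_mul_shift, neg_add_cancel, shift_zero]⟩

theorem isDownInv_ofFun {f g : ℤ → TimeSeries} (h : ∀ n, f n * g n = 1) :
    IsDownInv (ofFun f) (ofFun g) := by
  refine ⟨isDown_ofFun f, isDown_ofFun g, ?_, ?_⟩ <;> rw [ofFun_mul_ofFun, ← ofFun_one] <;>
    congr 1 <;> funext n
  · exact h n
  · rw [mul_comm, h n]
theorem isUpInv_ofFun {f g : ℤ → TimeSeries} (h : ∀ n, f n * g n = 1) :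
    IsUpInv (ofFun f) (ofFun g) := by simpa using (isDownInv_ofFun h).adj

theorem IsDown.sub {A B : PDO} (hA : A.IsDown) (hB : B.IsDown) : (A - B).IsDown :=
  ((⟨A, hA⟩ : DownOp) - ⟨B, hB⟩).2
theorem IsUp.sub {A B : PDO} (hA : A.IsUp) (hB : B.IsUp) : (A - B).IsUp :=
  ((⟨A, hA⟩ : UpOp) - ⟨B, hB⟩).prop

theorem isDown_lamSub : lamSub.IsDown := (isDown_shift 1).sub (isDown_shift (-1))
theorem isUp_lamSub : lamSub.IsUp := (isUp_shift 1).sub (isUp_shift (-1))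

@[simp] theorem adj_lamSub : lamSub.adj = -lamSub := by
  rw [lamSub, adj_sub, adj_shift, adj_shift, neg_neg, neg_sub]

/-- The geometric series `∑_{k ≥ 0} Λ^{-1-2k}` inverting `Λ - Λ⁻¹`. -/
def lamInv : PDO := ⟨fun j _ => if j < 0 ∧ Odd j then 1 else 0⟩

theorem lamInv_coeff_neg_one (n : ℤ) : lamInv.coeff (-1) n = 1 := by
  change (if (-1 : ℤ) < 0 ∧ Odd (-1 : ℤ) then (1 : TimeSeries) else 0) = 1
  exact if_pos ⟨by norm_num, by decide⟩

theorem isDownInv_lamSub : IsDownInv lamSub lamInv := by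
  have hC : lamInv.IsDown := ⟨0, fun j n hj => if_neg (by lia)⟩
  have key : ∀ j : ℤ, (if j - 1 < 0 ∧ Odd (j - 1) then (1 : TimeSeries) else 0) -
      (if j + 1 < 0 ∧ Odd (j + 1) then 1 else 0) = if j = 0 then 1 else 0 := by
    intro j
    simp only [Int.odd_iff]
    by_cases h0 : j = 0
    · subst h0; norm_num
    · rw [if_neg h0, sub_eq_zero]
      exact if_congr (by lia) rfl rfl
  refine ⟨isDown_lamSub, hC, ?_, ?_⟩ <;> ext j n
  · have h : lamSub * lamInv = shift 1 * lamInv - shift (-1) * lamInv :=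
      congrArg DownOp.val (sub_mul (⟨_, isDown_shift 1⟩ : DownOp) ⟨_, isDown_shift (-1)⟩ ⟨_, hC⟩)
    rw [h, coeff_sub, coeff_shift_mul, coeff_shift_mul, coeff_one, sub_neg_eq_add]
    exact congrArg _ (key j)
  · have h : lamInv * lamSub = lamInv * shift 1 - lamInv * shift (-1) :=
      congrArg DownOp.val (mul_sub (⟨_, hC⟩ : DownOp) ⟨_, isDown_shift 1⟩ ⟨_, isDown_shift (-1)⟩)
    rw [h, coeff_sub, coeff_mul_shift, coeff_mul_shift, coeff_one, sub_neg_eq_add]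
    exact congrArg _ (key j)

theorem isUpInv_lamSub : IsUpInv lamSub (-lamInv.adj) := by
  simpa using isDownInv_lamSub.adj.neg

end PDO

/-! ### Action on wave functions -/

theorem coeff_mul_congr {α : ℕ+ →₀ ℕ} (A : TimeSeries) {G H : TimeSeries}
    (h : ∀ β ≤ α, MvPowerSeries.coeff β G = MvPowerSeries.coeff β H) :
    MvPowerSeries.coeff α (A * G) = MvPowerSeries.coeff α (A * H) := by
  classical
  rw [MvPowerSeries.coeff_mul, MvPowerSeries.coeff_mul]
  refine Finset.sum_congr rfl fun x hx => ?_
  rw [h x.2 (by rw [← Finset.HasAntidiagonal.mem_antidiagonal.1 hx]; exact le_add_self)]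

/-- `F(n, t, z)` is locally finite: up to a given monomial in `t`, only finitely many sites `n`
contribute to a given power of `z`.  This makes the action of every formal operator converge. -/
def LocFin (F : ZFun) : Prop :=
  ∀ (m : ℤ) (α : ℕ+ →₀ ℕ), ∃ J : Finset ℤ, ∀ p ∉ J, ∀ β ≤ α,
    MvPowerSeries.coeff β (F p m) = 0

/-- The action as a finite sum over the sites `p = n + j`; the set `J` of sites may be chosen
independently of `A` and `n`. -/
theorem coeff_act {F : ZFun} {m : ℤ} {α : ℕ+ →₀ ℕ} {J : Finset ℤ}
    (hJ : ∀ p ∉ J, ∀ β ≤ α, MvPowerSeries.coeff β (F p m) = 0) (A : PDO) (n : ℤ) :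
    MvPowerSeries.coeff α (act A F n m) =
      MvPowerSeries.coeff α (∑ p ∈ J, A.coeff (p - n) n * F p m) := by
  have h : MvPowerSeries.coeff α (act A F n m) =
      ∑ᶠ j : ℤ, MvPowerSeries.coeff α (A.coeff j n * F (n + j) m) := rfl
  rw [h, ← finsum_comp_equiv (Equiv.addRight (-n)),
    finsum_eq_sum_of_support_subset (s := J), map_sum]
  · refine Finset.sum_congr rfl fun p _ => ?_
    rw [Equiv.coe_addRight, show n + (p + -n) = p by ring, sub_eq_add_neg]
  · intro p hp
    by_contra hpJ
    refine hp ?_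
    have h0 := coeff_mul_congr (A.coeff (p + -n) n) (G := F p m) (H := 0) (α := α)
      (fun β hβ => by rw [hJ p hpJ β hβ, map_zero])
    rw [mul_zero, map_zero] at h0
    change MvPowerSeries.coeff α (A.coeff (p + -n) n * F (n + (p + -n)) m) = 0
    rwa [show n + (p + -n) = p by ring]

theorem act_add (A B : PDO) {F : ZFun} (hF : LocFin F) : act (A + B) F = act A F + act B F := by
  funext n m
  ext α
  obtain ⟨J, hJ⟩ := hF m α
  rw [Pi.add_apply, Pi.add_apply, map_add, coeff_act hJ, coeff_act hJ, coeff_act hJ, ← map_add,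
    ← Finset.sum_add_distrib]
  simp only [coeff_add, add_mul]

theorem act_neg (A : PDO) (F : ZFun) : act (-A) F = -act A F := by
  funext n m
  ext α
  have h : ∀ j : ℤ, MvPowerSeries.coeff α ((-A).coeff j n * F (n + j) m) =
      -MvPowerSeries.coeff α (A.coeff j n * F (n + j) m) := fun j => by
    rw [coeff_neg, neg_mul, map_neg]
  exact (finsum_congr h).trans (finsum_neg_distrib _)

theorem act_mul_shift (A : PDO) (k : ℤ) (F : ZFun) :
    act (A * shift k) F = act A fun n => F (n + k) := by
  funext n m
  ext α
  change ∑ᶠ j : ℤ, MvPowerSeries.coeff α ((A * shift k).coeff j n * F (n + j) m) =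
    ∑ᶠ j : ℤ, MvPowerSeries.coeff α (A.coeff j n * F (n + j + k) m)
  rw [← finsum_comp_equiv (Equiv.addRight k)]
  refine finsum_congr fun j => ?_
  rw [Equiv.coe_addRight, coeff_mul_shift, add_sub_cancel_right, add_assoc]

/-- `A` is a finite sum `∑ a_j Λ^j`. -/
def IsBanded (A : PDO) : Prop := A.IsDown ∧ A.IsUp

theorem IsBanded.exists_bound {A : PDO} (hA : IsBanded A) :
    ∃ a b : ℤ, ∀ i ∉ Finset.Icc a b, ∀ n, A.coeff i n = 0 := by
  obtain ⟨⟨b, hb⟩, ⟨a, ha⟩⟩ := hA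
  refine ⟨a, b, fun i hi n => ?_⟩
  rw [Finset.mem_Icc, not_and_or, not_le, not_le] at hi
  exact hi.elim (ha i n) (hb i n)

theorem act_eq_sum {A : PDO} {s : Finset ℤ} (hs : ∀ i ∉ s, ∀ n, A.coeff i n = 0) (F : ZFun)
    (n m : ℤ) : act A F n m = ∑ i ∈ s, A.coeff i n * F (n + i) m := by
  ext α
  rw [map_sum]
  refine finsum_eq_sum_of_support_subset _ fun i hi => ?_
  by_contra h
  refine hi ?_
  change MvPowerSeries.coeff α (A.coeff i n * F (n + i) m) = 0
  rw [hs i h n, zero_mul, map_zero]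

theorem IsBanded.coeff_mul {A : PDO} {s : Finset ℤ} (hs : ∀ i ∉ s, ∀ n, A.coeff i n = 0)
    (B : PDO) (j n : ℤ) :
    (A * B).coeff j n = ∑ i ∈ s, A.coeff i n * B.coeff (j - i) (n + i) := by
  rw [PDO.coeff_mul]
  refine finsum_eq_sum_of_support_subset _ fun i hi => ?_
  by_contra h
  exact hi (mul_eq_zero_of_left (hs i h n) _)

/-- Left multiplication by a difference operator is compatible with the action. -/
theorem act_mul {A : PDO} (hA : IsBanded A) (B : PDO) {F : ZFun} (hF : LocFin F) :
    act (A * B) F = act A (act B F) := by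
  obtain ⟨a, b, hs⟩ := hA.exists_bound
  funext n m
  ext α
  obtain ⟨J, hJ⟩ := hF m α
  rw [coeff_act hJ, act_eq_sum hs, map_sum _ _ (Finset.Icc a b)]
  have h : ∀ i ∈ Finset.Icc a b, MvPowerSeries.coeff α (A.coeff i n * act B F (n + i) m) =
      MvPowerSeries.coeff α
        (A.coeff i n * ∑ p ∈ J, B.coeff (p - (n + i)) (n + i) * F p m) := fun i _ =>
    coeff_mul_congr _ fun β hβ =>
      coeff_act (fun p hp γ hγ => hJ p hp γ (hγ.trans hβ)) B (n + i)
  rw [Finset.sum_congr rfl h, ← map_sum]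
  congr 1
  simp only [IsBanded.coeff_mul hs, Finset.mul_sum, Finset.sum_mul]
  rw [Finset.sum_comm]
  refine Finset.sum_congr rfl fun i _ => Finset.sum_congr rfl fun p _ => ?_
  rw [sub_add_eq_sub_sub, mul_assoc]

/-- The derivative `∂F/∂t_k` of a function of `(n, t, z)`. -/
def ZFun.pd (k : ℕ+) (F : ZFun) : ZFun := fun n m => MvPowerSeries.pderiv ℂ k (F n m)

/-- The Leibniz rule for the action of an operator. -/
theorem pd_act (k : ℕ+) (A : PDO) {F : ZFun} (hF : LocFin F) :
    ZFun.pd k (act A F) = act (PDO.pd k A) F + act A (ZFun.pd k F) := by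
  funext n m
  ext α
  obtain ⟨J, hJ⟩ := hF m (α + Finsupp.single k 1)
  have hJ₁ : ∀ p ∉ J, ∀ β ≤ α, MvPowerSeries.coeff β (F p m) = 0 := fun p hp β hβ =>
    hJ p hp β (hβ.trans le_self_add)
  have hJ₂ : ∀ p ∉ J, ∀ β ≤ α, MvPowerSeries.coeff β (ZFun.pd k F p m) = 0 := fun p hp β hβ => by
    rw [ZFun.pd, MvPowerSeries.coeff_pderiv, hJ p hp _ (add_le_add_left hβ _), zero_mul]
  rw [Pi.add_apply, Pi.add_apply, map_add, coeff_act hJ₁, coeff_act hJ₂, ZFun.pd,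
    MvPowerSeries.coeff_pderiv, coeff_act hJ, ← MvPowerSeries.coeff_pderiv, ← map_add, map_sum,
    ← Finset.sum_add_distrib]
  congr 1
  refine Finset.sum_congr rfl fun p _ => ?_
  rw [Derivation.leibniz, smul_eq_mul, smul_eq_mul, coeff_pd, ZFun.pd]
  ring

/-! ### The exponential series -/

/-- The weighted degree `∑ k α_k` of the monomial `∏ t_k^{α_k}`. -/
def weight (α : ℕ+ →₀ ℕ) : ℤ := α.sum fun k a => ((k : ℕ) : ℤ) * (a : ℤ)

theorem weight_add (α β : ℕ+ →₀ ℕ) : weight (α + β) = weight α + weight β :=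
  Finsupp.sum_add_index' (by simp) (by intros; push_cast; ring)

theorem weight_single (k : ℕ+) : weight (Finsupp.single k 1) = ((k : ℕ) : ℤ) := by
  rw [weight, Finsupp.sum_single_index (by simp)]; simp

theorem weight_nonneg (α : ℕ+ →₀ ℕ) : 0 ≤ weight α :=
  Finset.sum_nonneg fun _ _ => by positivity

theorem weight_mono {α β : ℕ+ →₀ ℕ} (h : α ≤ β) : weight α ≤ weight β := by
  rw [← add_tsub_cancel_of_le h, weight_add]
  exact le_add_of_nonneg_right (weight_nonneg _)

theorem coeff_expXi (ε : ℂ) (m : ℤ) (α : ℕ+ →₀ ℕ) : MvPowerSeries.coeff α (expXi ε m) =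
    if weight α = m then α.prod fun _ a => ε ^ a / (a.factorial : ℂ) else 0 := rfl

theorem coeff_expXi_of_ne {ε : ℂ} {m : ℤ} {α : ℕ+ →₀ ℕ} (h : weight α ≠ m) :
    MvPowerSeries.coeff α (expXi ε m) = 0 := by rw [coeff_expXi, if_neg h]

theorem constantCoeff_expXi (ε : ℂ) (m : ℤ) :
    MvPowerSeries.constantCoeff (expXi ε m) = if m = 0 then 1 else 0 := by
  rw [← MvPowerSeries.coeff_zero_eq_constantCoeff_apply, coeff_expXi]
  simp [weight, eq_comm]

theorem pderiv_expXi (ε : ℂ) (k : ℕ+) (m : ℤ) :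
    MvPowerSeries.pderiv ℂ k (expXi ε m) = MvPowerSeries.C ε * expXi ε (m - ((k : ℕ) : ℤ)) := by
  ext α
  rw [MvPowerSeries.coeff_pderiv, MvPowerSeries.coeff_C_mul, coeff_expXi, coeff_expXi, weight_add,
    weight_single]
  by_cases h : weight α + ((k : ℕ) : ℤ) = m
  · rw [if_pos h, if_pos (by lia)]
    set s : Finset ℕ+ := insert k α.support with hs
    have hk : k ∈ s := Finset.mem_insert_self _ _
    rw [Finsupp.prod_of_support_subset (s := s) _ _ _ (by simp),
      Finsupp.prod_of_support_subset α (s := s) (Finset.subset_insert _ _) _ (by simp),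
      ← Finset.mul_prod_erase s _ hk, ← Finset.mul_prod_erase s _ hk]
    · have h₁ : ∀ i ∈ s.erase k, ε ^ (α + Finsupp.single k 1 : ℕ+ →₀ ℕ) i /
          (((α + Finsupp.single k 1 : ℕ+ →₀ ℕ) i).factorial : ℂ) =
          ε ^ α i / ((α i).factorial : ℂ) := fun i hi => by
        rw [Finsupp.add_apply, Finsupp.single_eq_of_ne (Finset.ne_of_mem_erase hi), add_zero]
      rw [Finset.prod_congr rfl h₁, Finsupp.add_apply, Finsupp.single_eq_same, pow_succ,
        Nat.factorial_succ]
      have h₂ : ((α k).factorial : ℂ) ≠ 0 := Nat.cast_ne_zero.2 (Nat.factorial_ne_zero _)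
      have h₃ : ((α k : ℂ) + 1) ≠ 0 := by exact_mod_cast Nat.succ_ne_zero (α k)
      push_cast
      field_simp
    · intro i hi
      rw [hs, Finset.mem_insert]
      by_contra! hne
      rw [Finsupp.mem_support_iff, Finsupp.add_apply, Finsupp.single_eq_of_ne hne.1,
        Finsupp.notMem_support_iff.1 hne.2] at hi
      exact hi rfl
  · rw [if_neg h, if_neg (by lia), zero_mul, mul_zero]

/-- A wave function whose coefficient of `z^m` at the site `n` is homogeneous of weighted degree
`ℓ m n` is locally finite when each range `0 ≤ ℓ m n ≤ w` contains finitely many sites. -/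
theorem locFin_of_weight {F : ZFun} (ℓ : ℤ → ℤ → ℤ)
    (hF : ∀ n m α, MvPowerSeries.coeff α (F n m) ≠ 0 → weight α = ℓ m n)
    (hℓ : ∀ m w, ∃ J : Finset ℤ, ∀ n, 0 ≤ ℓ m n → ℓ m n ≤ w → n ∈ J) : LocFin F := by
  intro m α
  obtain ⟨J, hJ⟩ := hℓ m (weight α)
  refine ⟨J, fun p hp β hβ => ?_⟩
  by_contra h
  have hw := hF p m β h
  exact hp (hJ p (hw ▸ weight_nonneg β) (hw ▸ weight_mono hβ))

theorem locFin_expUp (ε : ℂ) : LocFin (expUp ε) :=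
  locFin_of_weight (fun m n => m - n) (fun n m α h => not_not.1 fun hw => h (coeff_expXi_of_ne hw))
    fun m w => ⟨Finset.Icc (m - w) m, fun n h₁ h₂ => by rw [Finset.mem_Icc]; lia⟩
theorem locFin_expDown (ε : ℂ) : LocFin (expDown ε) :=
  locFin_of_weight (fun m n => n - m) (fun n m α h => not_not.1 fun hw => h (coeff_expXi_of_ne hw))
    fun m w => ⟨Finset.Icc m (m + w), fun n h₁ h₂ => by rw [Finset.mem_Icc]; lia⟩
theorem locFin_expDownNeg (ε : ℂ) : LocFin (expDownNeg ε) :=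
  locFin_of_weight (fun m n => m + n) (fun n m α h => not_not.1 fun hw => h (coeff_expXi_of_ne hw))
    fun m w => ⟨Finset.Icc (-m) (w - m), fun n h₁ h₂ => by rw [Finset.mem_Icc]; lia⟩
theorem locFin_expUpNeg (ε : ℂ) : LocFin (expUpNeg ε) :=
  locFin_of_weight (fun m n => -n - m)
    (fun n m α h => not_not.1 fun hw => h (coeff_expXi_of_ne hw))
    fun m w => ⟨Finset.Icc (-m - w) (-m), fun n h₁ h₂ => by rw [Finset.mem_Icc]; lia⟩

namespace PDO

protected theorem neg_mul (A B : PDO) : -A * B = -(A * B) := by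
  ext1; funext j n
  rw [coeff_neg, coeff_mul, coeff_mul, ← finsum_neg_distrib]
  exact finsum_congr fun i => by rw [coeff_neg, _root_.neg_mul]

end PDO

theorem DownOp.shift_one_pow (k : ℕ) :
    (⟨shift 1, isDown_shift 1⟩ : DownOp) ^ k = ⟨shift (k : ℤ), isDown_shift k⟩ := by
  induction k with
  | zero => rfl
  | succ k ih =>
    rw [pow_succ, ih]
    exact DownOp.ext (by push_cast; exact shift_mul_shift k 1)

theorem UpOp.shift_neg_one_pow (k : ℕ) :
    (⟨shift (-1), isUp_shift (-1)⟩ : UpOp) ^ k = ⟨shift (-(k : ℤ)), isUp_shift _⟩ := by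
  induction k with
  | zero => rfl
  | succ k ih =>
    rw [pow_succ, ih]
    exact UpOp.ext ((shift_mul_shift (-(k : ℤ)) (-1)).trans (by push_cast; rw [neg_add]))

/-! ### Flows of dressing operators -/

/-- If `∂s = m s - s q`, then `L = s l s⁻¹`, with `l` constant and commuting with `q`, satisfies
the Lax equation; the hypothesis `h` is the derivative of `L s = s l`. -/
theorem lax_of_dressing {R : Type*} [Ring R] {s c m l q L ds dL : R} (hsc : s * c = 1)
    (hL : L * s = s * l) (hlq : q * l = l * q) (hds : ds = m * s - s * q)
    (h : dL * s + L * ds = ds * l) : dL = m * L - L * m := by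
  have h₁ : dL * s = (m * L - L * m) * s := by
    calc dL * s = ds * l - L * ds := eq_sub_of_add_eq h
      _ = m * (s * l) - s * (q * l) - (L * m * s - L * s * q) := by rw [hds]; noncomm_ring
      _ = (m * L - L * m) * s := by
        rw [hL, hlq, ← hL, ← mul_assoc s l q, ← hL]
        noncomm_ring
  calc dL = dL * s * c := by rw [mul_assoc, hsc, mul_one]
    _ = m * L - L * m := by rw [h₁, mul_assoc, hsc, mul_one]

/-- The inverse of a solution of `∂s = m s - s q`; the hypothesis `h` is the derivative of
`s c = 1`. -/
theorem deriv_inv_of_flow {R : Type*} [Ring R] {s c m q ds dc : R} (hsc : s * c = 1)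
    (hcs : c * s = 1) (hds : ds = m * s - s * q) (h : ds * c + s * dc = 0) :
    dc = q * c - c * m := by
  calc dc = c * s * dc := by rw [hcs, one_mul]
    _ = -(c * (ds * c)) := by rw [mul_assoc, eq_neg_of_add_eq_zero_right h, mul_neg]
    _ = c * s * q * c - c * m * (s * c) := by rw [hds]; noncomm_ring
    _ = q * c - c * m := by rw [hsc, hcs, one_mul, mul_one]

/-- Dressing operators `S₁` (in powers of `Λ⁻¹`) and `S₂` (in powers of `Λ`), with inverses
`C₁` and `C₂`, evolving under one family of difference operators `M k`, as for the Toda flow along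
`∂/∂x_k - ∂/∂y_k`. -/
structure TodaFlow (S₁ C₁ S₂ C₂ : PDO) (M : ℕ+ → PDO) : Prop where
  inv₁ : IsDownInv S₁ C₁
  inv₂ : IsUpInv S₂ C₂
  banded : ∀ k, IsBanded (M k)
  flow₁ : ∀ k, pd k S₁ = M k * S₁ - S₁ * shift ((k : ℕ) : ℤ)
  flow₂ : ∀ k, pd k S₂ = M k * S₂ + S₂ * shift (-((k : ℕ) : ℤ))

namespace TodaFlow

variable {S₁ C₁ S₂ C₂ : PDO} {M : ℕ+ → PDO}

theorem pd_inv₁ (h : TodaFlow S₁ C₁ S₂ C₂ M) (k : ℕ+) :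
    pd k C₁ = shift ((k : ℕ) : ℤ) * C₁ - C₁ * M k := by
  let s : DownOp := ⟨S₁, h.inv₁.1⟩
  let c : DownOp := ⟨C₁, h.inv₁.2⟩
  let m : DownOp := ⟨M k, (h.banded k).1⟩
  let q : DownOp := ⟨shift ((k : ℕ) : ℤ), isDown_shift _⟩
  let ds : DownOp := ⟨pd k S₁, h.inv₁.1.pd k⟩
  let dc : DownOp := ⟨pd k C₁, h.inv₁.2.pd k⟩
  have hd : ds * c + s * dc = 0 := DownOp.ext <| by
    change pd k S₁ * C₁ + S₁ * pd k C₁ = 0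
    rw [← pd_mul_of_isDown k h.inv₁.1 h.inv₁.2, h.inv₁.3, pd_one]
  exact congrArg DownOp.val (deriv_inv_of_flow (s := s) (c := c) (m := m) (q := q)
    (DownOp.ext h.inv₁.3) (DownOp.ext h.inv₁.4) (DownOp.ext (h.flow₁ k)) hd)

theorem pd_inv₂ (h : TodaFlow S₁ C₁ S₂ C₂ M) (k : ℕ+) :
    pd k C₂ = -(shift (-((k : ℕ) : ℤ)) * C₂) - C₂ * M k := by
  let s : UpOp := ⟨S₂, h.inv₂.1⟩
  let c : UpOp := ⟨C₂, h.inv₂.2⟩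
  let m : UpOp := ⟨M k, (h.banded k).2⟩
  let q : UpOp := ⟨shift (-((k : ℕ) : ℤ)), isUp_shift _⟩
  let ds : UpOp := ⟨pd k S₂, h.inv₂.1.pd k⟩
  let dc : UpOp := ⟨pd k C₂, h.inv₂.2.pd k⟩
  have hd : ds * c + s * dc = 0 := UpOp.ext <| by
    change pd k S₂ * C₂ + S₂ * pd k C₂ = 0
    rw [← pd_mul_of_isUp k h.inv₂.1 h.inv₂.2, h.inv₂.3, pd_one]
  have hds : ds = m * s - s * -q := by
    rw [mul_neg, sub_neg_eq_add]; exact UpOp.ext (h.flow₂ k)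
  have := deriv_inv_of_flow (UpOp.ext h.inv₂.3) (UpOp.ext h.inv₂.4) hds hd
  rw [neg_mul] at this
  exact congrArg UpOp.val this

theorem adj_pd_inv₁ (h : TodaFlow S₁ C₁ S₂ C₂ M) (k : ℕ+) :
    pd k C₁.adj = -(M k).adj * C₁.adj + C₁.adj * shift (-((k : ℕ) : ℤ)) := by
  rw [← adj_pd, h.pd_inv₁ k, adj_sub, adj_mul, adj_mul, adj_shift, PDO.neg_mul, sub_eq_add_neg,
    add_comm]

theorem adj_pd_inv₂ (h : TodaFlow S₁ C₁ S₂ C₂ M) (k : ℕ+) :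
    pd k C₂.adj = -(M k).adj * C₂.adj - C₂.adj * shift ((k : ℕ) : ℤ) := by
  rw [← adj_pd, h.pd_inv₂ k, adj_sub, adj_neg, adj_mul, adj_mul, adj_shift, neg_neg, PDO.neg_mul]
  abel

end TodaFlow

/-! ### The evolution equations -/

section Evolution

variable {𝒯 : TodaObjects} {C₁ C₂ : PDO} {M : ℕ+ → PDO}

theorem L₁_semiconj (hT : 𝒯.HasTodaForm) (h : IsDownInv 𝒯.S₁ C₁) :
    𝒯.L₁.IsDown ∧ 𝒯.L₁ * 𝒯.S₁ = 𝒯.S₁ * shift 1 := by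
  have hL : 𝒯.L₁ = 𝒯.S₁ * shift 1 * C₁ := by rw [hT.L₁_dressing, h.invDown_eq]
  refine ⟨by rw [hL]; exact (h.1.mul (isDown_shift 1)).mul h.2, ?_⟩
  rw [hL, IsDown.mul_assoc (h.1.mul (isDown_shift 1)) h.2 h.1, h.4, PDO.mul_one]

theorem L₂_semiconj (hT : 𝒯.HasTodaForm) (h : IsUpInv 𝒯.S₂ C₂) :
    𝒯.L₂.IsUp ∧ 𝒯.L₂ * 𝒯.S₂ = 𝒯.S₂ * shift (-1) := by
  have hL : 𝒯.L₂ = 𝒯.S₂ * shift (-1) * C₂ := by rw [hT.L₂_dressing, h.invUp_eq]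
  refine ⟨by rw [hL]; exact (h.1.mul (isUp_shift (-1))).mul h.2, ?_⟩
  rw [hL, IsUp.mul_assoc (h.1.mul (isUp_shift (-1))) h.2 h.1, h.4, PDO.mul_one]

theorem pd_S₁_eq (hT : 𝒯.HasTodaForm) (h : TodaFlow 𝒯.S₁ C₁ 𝒯.S₂ C₂ M) (k : ℕ+) :
    (𝒯.L₁ ^ (k : ℕ)).IsDown ∧ pd k 𝒯.S₁ = (M k - 𝒯.L₁ ^ (k : ℕ)) * 𝒯.S₁ := by
  obtain ⟨hL, hLS⟩ := L₁_semiconj hT h.inv₁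
  let L : DownOp := ⟨𝒯.L₁, hL⟩
  let s : DownOp := ⟨𝒯.S₁, h.inv₁.1⟩
  let m : DownOp := ⟨M k, (h.banded k).1⟩
  let l : DownOp := ⟨shift 1, isDown_shift 1⟩
  have hs : SemiconjBy s l L := DownOp.ext hLS.symm
  have hk : s * l ^ (k : ℕ) = L ^ (k : ℕ) * s := hs.pow_right k
  have h₁ : (⟨pd k 𝒯.S₁, h.inv₁.1.pd k⟩ : DownOp) = m * s - s * l ^ (k : ℕ) := by
    rw [DownOp.shift_one_pow]; exact DownOp.ext (h.flow₁ k)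
  rw [hk, ← sub_mul] at h₁
  rw [← DownOp.val_pow L]
  exact ⟨(L ^ (k : ℕ)).prop, congrArg DownOp.val h₁⟩

theorem pd_S₂_eq (hT : 𝒯.HasTodaForm) (h : TodaFlow 𝒯.S₁ C₁ 𝒯.S₂ C₂ M) (k : ℕ+) :
    (𝒯.L₂ ^ (k : ℕ)).IsUp ∧ pd k 𝒯.S₂ = (M k + 𝒯.L₂ ^ (k : ℕ)) * 𝒯.S₂ := by
  obtain ⟨hL, hLS⟩ := L₂_semiconj hT h.inv₂
  let L : UpOp := ⟨𝒯.L₂, hL⟩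
  let s : UpOp := ⟨𝒯.S₂, h.inv₂.1⟩
  let m : UpOp := ⟨M k, (h.banded k).2⟩
  let l : UpOp := ⟨shift (-1), isUp_shift (-1)⟩
  have hs : SemiconjBy s l L := UpOp.ext hLS.symm
  have hk : s * l ^ (k : ℕ) = L ^ (k : ℕ) * s := hs.pow_right k
  have h₁ : (⟨pd k 𝒯.S₂, h.inv₂.1.pd k⟩ : UpOp) = m * s + s * l ^ (k : ℕ) := by
    rw [UpOp.shift_neg_one_pow]; exact UpOp.ext (h.flow₂ k)
  rw [hk, ← add_mul] at h₁
  rw [← UpOp.val_pow L]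
  exact ⟨(L ^ (k : ℕ)).prop, congrArg UpOp.val h₁⟩

/-- Since `(∂𝒮₁)𝒮₁⁻¹` has only negative powers of `Λ`, the nonnegative part of `M` is that
of `ℒ₁^k`. -/
theorem coeff_flow_of_nonneg (hT : 𝒯.HasTodaForm) (h : TodaFlow 𝒯.S₁ C₁ 𝒯.S₂ C₂ M) (k : ℕ+)
    {j : ℤ} (hj : 0 ≤ j) (n : ℤ) : (M k).coeff j n = (𝒯.L₁ ^ (k : ℕ)).coeff j n := by
  obtain ⟨hL, hd⟩ := pd_S₁_eq hT h k
  have hD : M k - 𝒯.L₁ ^ (k : ℕ) = pd k 𝒯.S₁ * C₁ := by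
    rw [hd, IsDown.mul_assoc ((h.banded k).1.sub hL) h.inv₁.1 h.inv₁.2, h.inv₁.3, PDO.mul_one]
  have hdS : OrderLE (-1) (pd k 𝒯.S₁) := fun j n hj => by
    rw [coeff_pd]
    rcases eq_or_lt_of_le (show 0 ≤ j by lia) with rfl | hj
    · rw [hT.S₁_lead]; exact MvPowerSeries.pderiv_one
    · rw [hT.S₁_form j n hj, map_zero]
  have h₀ := hdS.mul (OrderLE.of_isDownInv hT.S₁_form
    (fun n => by rw [hT.S₁_lead n]; exact isUnit_one) h.inv₁) j n (by lia)
  rw [← hD, coeff_sub] at h₀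
  exact sub_eq_zero.1 h₀

/-- Since `(∂𝒮₂)𝒮₂⁻¹` has only nonnegative powers of `Λ`, the negative part of `M` is minus that
of `ℒ₂^k`. -/
theorem coeff_flow_of_neg (hT : 𝒯.HasTodaForm) (h : TodaFlow 𝒯.S₁ C₁ 𝒯.S₂ C₂ M) (k : ℕ+)
    {j : ℤ} (hj : j < 0) (n : ℤ) : (M k).coeff j n = -(𝒯.L₂ ^ (k : ℕ)).coeff j n := by
  obtain ⟨hL, hd⟩ := pd_S₂_eq hT h k
  have hD : M k + 𝒯.L₂ ^ (k : ℕ) = pd k 𝒯.S₂ * C₂ := by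
    rw [hd, IsUp.mul_assoc ((h.banded k).2.add hL) h.inv₂.1 h.inv₂.2, h.inv₂.3, PDO.mul_one]
  have hdS : OrderGE 0 (pd k 𝒯.S₂) := fun j n hj => by
    rw [coeff_pd, hT.S₂_form j n hj, map_zero]
  have h₁ := hdS.mul (OrderGE.of_isUpInv hT.S₂_form hT.S₂_lead h.inv₂) j n (by lia)
  rw [← hD, coeff_add] at h₁
  exact eq_neg_of_add_eq_zero_left h₁

/-- The common generator is forced to be the one of the Toda hierarchy. -/
theorem flow_eq (hT : 𝒯.HasTodaForm) (h : TodaFlow 𝒯.S₁ C₁ 𝒯.S₂ C₂ M) (k : ℕ+) :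
    M k = ge 0 (𝒯.L₁ ^ (k : ℕ)) - lt 0 (𝒯.L₂ ^ (k : ℕ)) := by
  ext1; funext j n
  rw [coeff_sub, coeff_ge, coeff_lt]
  rcases lt_or_ge j 0 with hj | hj
  · rw [if_neg (not_le.2 hj), if_pos hj, coeff_flow_of_neg hT h k hj, zero_sub]
  · rw [if_pos hj, if_neg (not_lt.2 hj), coeff_flow_of_nonneg hT h k hj, sub_zero]

theorem ge_add_lt (A : PDO) : ge 0 A + lt 0 A = A := by
  ext1; funext j n
  rw [coeff_add, coeff_ge, coeff_lt]
  rcases lt_or_ge j 0 with hj | hj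
  · rw [if_neg (not_le.2 hj), if_pos hj, zero_add]
  · rw [if_pos hj, if_neg (not_lt.2 hj), add_zero]

theorem TodaFlow.evolution (hT : 𝒯.HasTodaForm) (h : TodaFlow 𝒯.S₁ C₁ 𝒯.S₂ C₂ M) :
    𝒯.Evolution where
  lax₁ k := by
    rw [← flow_eq hT h k]
    obtain ⟨hL, hLS⟩ := L₁_semiconj hT h.inv₁
    let L : DownOp := ⟨𝒯.L₁, hL⟩
    let s : DownOp := ⟨𝒯.S₁, h.inv₁.1⟩
    let c : DownOp := ⟨C₁, h.inv₁.2⟩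
    let m : DownOp := ⟨M k, (h.banded k).1⟩
    let l : DownOp := ⟨shift 1, isDown_shift 1⟩
    let q : DownOp := ⟨shift ((k : ℕ) : ℤ), isDown_shift _⟩
    let ds : DownOp := ⟨pd k 𝒯.S₁, h.inv₁.1.pd k⟩
    let dL : DownOp := ⟨pd k 𝒯.L₁, hL.pd k⟩
    have hd : dL * s + L * ds = ds * l := DownOp.ext <| by
      change pd k 𝒯.L₁ * 𝒯.S₁ + 𝒯.L₁ * pd k 𝒯.S₁ = pd k 𝒯.S₁ * shift 1
      rw [← pd_mul_of_isDown k hL h.inv₁.1, hLS, pd_mul_of_isDown k h.inv₁.1 (isDown_shift 1),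
        pd_shift, PDO.mul_zero, add_zero]
    have hlq : q * l = l * q := DownOp.ext <| by
      change shift ((k : ℕ) : ℤ) * shift 1 = shift 1 * shift ((k : ℕ) : ℤ)
      rw [shift_mul_shift, shift_mul_shift, add_comm]
    exact congrArg DownOp.val (lax_of_dressing (s := s) (c := c) (m := m) (l := l) (q := q)
      (DownOp.ext h.inv₁.3) (DownOp.ext hLS) hlq (DownOp.ext (h.flow₁ k)) hd)
  lax₂ k := by
    rw [← flow_eq hT h k]
    obtain ⟨hL, hLS⟩ := L₂_semiconj hT h.inv₂
    let L : UpOp := ⟨𝒯.L₂, hL⟩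
    let s : UpOp := ⟨𝒯.S₂, h.inv₂.1⟩
    let c : UpOp := ⟨C₂, h.inv₂.2⟩
    let m : UpOp := ⟨M k, (h.banded k).2⟩
    let l : UpOp := ⟨shift (-1), isUp_shift (-1)⟩
    let q : UpOp := ⟨shift (-((k : ℕ) : ℤ)), isUp_shift _⟩
    let ds : UpOp := ⟨pd k 𝒯.S₂, h.inv₂.1.pd k⟩
    let dL : UpOp := ⟨pd k 𝒯.L₂, hL.pd k⟩
    have hd : dL * s + L * ds = ds * l := UpOp.ext <| by
      change pd k 𝒯.L₂ * 𝒯.S₂ + 𝒯.L₂ * pd k 𝒯.S₂ = pd k 𝒯.S₂ * shift (-1)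
      rw [← pd_mul_of_isUp k hL h.inv₂.1, hLS, pd_mul_of_isUp k h.inv₂.1 (isUp_shift (-1)),
        pd_shift, PDO.mul_zero, add_zero]
    have hlq : -q * l = l * -q := by
      rw [neg_mul, mul_neg]
      refine congrArg _ (UpOp.ext ?_)
      change shift (-((k : ℕ) : ℤ)) * shift (-1) = shift (-1) * shift (-((k : ℕ) : ℤ))
      rw [shift_mul_shift, shift_mul_shift, add_comm]
    have hds : ds = m * s - s * -q := by
      rw [mul_neg, sub_neg_eq_add]; exact UpOp.ext (h.flow₂ k)
    exact congrArg UpOp.val (lax_of_dressing (c := c)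
      (UpOp.ext h.inv₂.3) (UpOp.ext hLS) hlq hds hd)
  wave₁ k := by
    rw [(pd_S₁_eq hT h k).2, ← PDO.neg_mul, flow_eq hT h k]
    congr 1
    nth_rw 2 [← ge_add_lt (𝒯.L₁ ^ (k : ℕ))]
    abel
  wave₂ k := by
    rw [(pd_S₂_eq hT h k).2, flow_eq hT h k]
    congr 1
    nth_rw 2 [← ge_add_lt (𝒯.L₂ ^ (k : ℕ))]
    abel

end Evolution

/-! ### The bilinear equation -/

/-- If `F` is a plane wave of the flow, `∂F = Λ^l F`, and `∂S = M S - S Λ^l`, then `S F` evolves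
under `M` alone. -/
theorem pd_act_of_flow {k : ℕ+} {S M : PDO} {F : ZFun} {l : ℤ} (hM : IsBanded M)
    (hF : LocFin F) (hFl : ZFun.pd k F = fun n => F (n + l))
    (hS : pd k S = M * S - S * shift l) : ZFun.pd k (act S F) = act M (act S F) := by
  rw [pd_act k S hF, hFl, ← act_mul_shift, ← act_add _ _ hF, hS, sub_add_cancel, act_mul hM S hF]

theorem act_neg_right (A : PDO) (F : ZFun) : act A (-F) = -act A F := by
  funext n m
  ext α
  have h : ∀ j : ℤ, MvPowerSeries.coeff α (A.coeff j n * (-F) (n + j) m) =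
      -MvPowerSeries.coeff α (A.coeff j n * F (n + j) m) := fun j => by
    rw [Pi.neg_apply, Pi.neg_apply, mul_neg, map_neg]
  exact (finsum_congr h).trans (finsum_neg_distrib _)

theorem pd_act_of_flow_neg {k : ℕ+} {S M : PDO} {F : ZFun} {l : ℤ} (hM : IsBanded M)
    (hF : LocFin F) (hFl : ZFun.pd k F = -fun n => F (n + l))
    (hS : pd k S = M * S + S * shift l) : ZFun.pd k (act S F) = act M (act S F) := by
  rw [pd_act k S hF, hFl, act_neg_right, ← act_mul_shift, hS, ← act_mul hM S hF,
    act_add _ _ hF, add_neg_cancel_right]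

theorem pd_expUp (k : ℕ+) : ZFun.pd k (expUp 1) = fun n => expUp 1 (n + ((k : ℕ) : ℤ)) := by
  funext n m
  rw [ZFun.pd, expUp, pderiv_expXi, map_one, one_mul, sub_sub, expUp]

theorem pd_expDown (k : ℕ+) :
    ZFun.pd k (expDown (-1)) = -fun n => expDown (-1) (n + -((k : ℕ) : ℤ)) := by
  funext n m
  rw [ZFun.pd, expDown, pderiv_expXi, map_neg, map_one, neg_one_mul]
  change -expXi _ _ = -expXi _ _
  congr 2; ring

theorem pd_expDownNeg (k : ℕ+) :
    ZFun.pd k (expDownNeg (-1)) = -fun n => expDownNeg (-1) (n + -((k : ℕ) : ℤ)) := by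
  funext n m
  rw [ZFun.pd, expDownNeg, pderiv_expXi, map_neg, map_one, neg_one_mul]
  change -expXi _ _ = -expXi _ _
  congr 2; ring

theorem pd_expUpNeg (k : ℕ+) :
    ZFun.pd k (expUpNeg 1) = fun n => expUpNeg 1 (n + ((k : ℕ) : ℤ)) := by
  funext n m
  rw [ZFun.pd, expUpNeg, pderiv_expXi, map_one, one_mul, expUpNeg]
  congr 1; ring

theorem res_symm (F G : ZFun) (n n' : ℤ) (α β : ℕ+ →₀ ℕ) :
    res F G n n' α β = res G F n' n β α := by
  rw [res, res, ← finsum_comp_equiv (Equiv.neg ℤ)]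
  refine finsum_congr fun m => ?_
  rw [resTerm, resTerm, Equiv.neg_apply, neg_neg, mul_comm]

/-- All residues of `F(n, t, z) G(n', t', z)` are finite sums. -/
def ResFinite (F G : ZFun) : Prop :=
  ∀ (n n' : ℤ) (α β : ℕ+ →₀ ℕ), (Function.support (resTerm F G n n' α β)).Finite

theorem ResFinite.symm {F G : ZFun} (h : ResFinite F G) : ResFinite G F := by
  intro n n' α β
  refine ((h n' n β α).image Neg.neg).subset fun m hm => ⟨-m, ?_, neg_neg m⟩
  rw [Function.mem_support, resTerm] at hm ⊢
  rwa [neg_neg, mul_comm]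

/-- If `∂F/∂t_k = M F` with `M` a difference operator, the residues obey the same equation. -/
theorem res_add_single {F G : ZFun} {k : ℕ+} {M : PDO} {s : Finset ℤ}
    (hs : ∀ i ∉ s, ∀ n, M.coeff i n = 0) (hF : ZFun.pd k F = act M F) (hfin : ResFinite F G)
    (n n' : ℤ) (α β : ℕ+ →₀ ℕ) :
    ((α k : ℂ) + 1) * res F G n n' (α + Finsupp.single k 1) β =
      ∑ i ∈ s, ∑ x ∈ Finset.HasAntidiagonal.antidiagonal α,
        MvPowerSeries.coeff x.1 (M.coeff i n) * res F G (n + i) n' x.2 β := by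
  have hterm : ∀ m, ((α k : ℂ) + 1) * resTerm F G n n' (α + Finsupp.single k 1) β m =
      ∑ i ∈ s, ∑ x ∈ Finset.HasAntidiagonal.antidiagonal α,
        MvPowerSeries.coeff x.1 (M.coeff i n) * resTerm F G (n + i) n' x.2 β m := fun m => by
    have h := congrArg (MvPowerSeries.coeff α) (congrFun (congrFun hF n) m)
    rw [ZFun.pd, MvPowerSeries.coeff_pderiv, act_eq_sum hs, map_sum] at h
    rw [resTerm, ← mul_assoc, mul_comm ((α k : ℂ) + 1), h, Finset.sum_mul]
    refine Finset.sum_congr rfl fun i _ => ?_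
    rw [MvPowerSeries.coeff_mul, Finset.sum_mul]
    exact Finset.sum_congr rfl fun x _ => mul_assoc _ _ _
  have hsupp : ∀ (c : ℂ) (i : ℤ) (γ : ℕ+ →₀ ℕ),
      (Function.support fun m => c * resTerm F G (n + i) n' γ β m).Finite := fun c i γ =>
    (hfin (n + i) n' γ β).subset (Function.support_const_smul_subset c _)
  rw [res, mul_finsum' _ _ (hfin _ _ _ _), finsum_congr hterm, finsum_sum_comm]
  · refine Finset.sum_congr rfl fun i _ => ?_
    rw [finsum_sum_comm _ _ fun x _ => hsupp _ _ _]
    exact Finset.sum_congr rfl fun x _ => (mul_finsum' _ _ (hfin _ _ _ _)).symm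
  · intro i _
    refine (Set.Finite.biUnion
      (Finset.finite_toSet (Finset.HasAntidiagonal.antidiagonal α)) fun x _ =>
        hsupp (MvPowerSeries.coeff x.1 (M.coeff i n)) i x.2).subset ?_
    exact Finset.support_sum _ _

/-- Two families of residues with the same linear evolution in `t` agree once they agree at
`t = 0`. -/
theorem res_eq_of_flow {F₁ F₂ G₁ G₂ : ZFun} {M : ℕ+ → PDO} (hM : ∀ k, IsBanded (M k))
    (h₁ : ∀ k, ZFun.pd k F₁ = act (M k) F₁) (h₂ : ∀ k, ZFun.pd k F₂ = act (M k) F₂)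
    (hf₁ : ResFinite F₁ G₁) (hf₂ : ResFinite F₂ G₂) {β : ℕ+ →₀ ℕ}
    (h₀ : ∀ n n', res F₁ G₁ n n' 0 β = res F₂ G₂ n n' 0 β) (α : ℕ+ →₀ ℕ) :
    ∀ n n', res F₁ G₁ n n' α β = res F₂ G₂ n n' α β := by
  induction hd : α.degree using Nat.strong_induction_on generalizing α with
  | _ d ih =>
    intro n n'
    by_cases hα : α = 0
    · rw [hα]; exact h₀ n n'
    obtain ⟨k, hk⟩ := Finsupp.ne_iff.1 hα
    obtain ⟨γ, rfl⟩ : ∃ γ, α = γ + Finsupp.single k 1 :=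
      ⟨α - Finsupp.single k 1, (tsub_add_cancel_of_le (Finsupp.single_le_iff.2
        (Nat.one_le_iff_ne_zero.2 hk))).symm⟩
    obtain ⟨a, b, hs⟩ := (hM k).exists_bound
    have hne : ((γ k : ℂ) + 1) ≠ 0 := by exact_mod_cast Nat.succ_ne_zero (γ k)
    refine mul_left_cancel₀ hne ?_
    rw [res_add_single hs (h₁ k) hf₁, res_add_single hs (h₂ k) hf₂]
    refine Finset.sum_congr rfl fun i _ => Finset.sum_congr rfl fun x hx => ?_
    have hx' := congrArg Finsupp.degree (Finset.HasAntidiagonal.mem_antidiagonal.1 hx)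
    have hdeg : (Finsupp.single k 1 : ℕ+ →₀ ℕ).degree = 1 := Finsupp.degree_single k 1
    rw [map_add] at hx' hd
    rw [ih x.2.degree (by lia) x.2 rfl]

theorem exists_of_coeff_act_ne_zero {A : PDO} {F : ZFun} {n m : ℤ} {α : ℕ+ →₀ ℕ}
    (h : MvPowerSeries.coeff α (act A F n m) ≠ 0) :
    ∃ j, A.coeff j n ≠ 0 ∧ ∃ β ≤ α, MvPowerSeries.coeff β (F (n + j) m) ≠ 0 := by
  obtain ⟨j, hj⟩ : ∃ j, MvPowerSeries.coeff α (A.coeff j n * F (n + j) m) ≠ 0 := by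
    by_contra! h'
    exact h ((finsum_congr h').trans finsum_zero)
  refine ⟨j, fun h0 => hj (by rw [h0, zero_mul, map_zero]), ?_⟩
  by_contra! hβ
  refine hj ?_
  rw [coeff_mul_congr (H := 0) _ fun β hβα => by rw [hβ β hβα, map_zero], mul_zero, map_zero]

theorem resFinite_expUp {A B : PDO} (hA : A.IsDown) (hB : B.IsUp) :
    ResFinite (act A (expUp 1)) (act B (expDownNeg (-1))) := by
  obtain ⟨a, hA⟩ := hA
  obtain ⟨b, hB⟩ := hB
  intro n n' α β
  refine (Set.finite_Icc (n' + b - weight β) (n + a + weight α)).subset fun m hm => ?_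
  obtain ⟨i, hi, γ, hγ, hiγ⟩ := exists_of_coeff_act_ne_zero (left_ne_zero_of_mul hm)
  obtain ⟨j, hj, δ, hδ, hjδ⟩ := exists_of_coeff_act_ne_zero (right_ne_zero_of_mul hm)
  have h₁ : weight γ = m - (n + i) := not_not.1 fun h => hiγ (coeff_expXi_of_ne h)
  have h₂ : weight δ = -m + (n' + j) := not_not.1 fun h => hjδ (coeff_expXi_of_ne h)
  have h₃ := weight_mono hγ
  have h₄ := weight_mono hδ
  have h₅ : i ≤ a := not_lt.1 fun h => hi (hA i n h)
  have h₆ : b ≤ j := not_lt.1 fun h => hj (hB j n' h)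
  rw [Set.mem_Icc]
  lia

theorem resFinite_expDown {A B : PDO} (hA : A.IsUp) (hB : B.IsDown) :
    ResFinite (act A (expDown (-1))) (act B (expUpNeg 1)) := by
  obtain ⟨a, hA⟩ := hA
  obtain ⟨b, hB⟩ := hB
  intro n n' α β
  refine (Set.finite_Icc (n + a - weight α) (n' + b + weight β)).subset fun m hm => ?_
  obtain ⟨i, hi, γ, hγ, hiγ⟩ := exists_of_coeff_act_ne_zero (left_ne_zero_of_mul hm)
  obtain ⟨j, hj, δ, hδ, hjδ⟩ := exists_of_coeff_act_ne_zero (right_ne_zero_of_mul hm)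
  have h₁ : weight γ = n + i - m := not_not.1 fun h => hiγ (coeff_expXi_of_ne h)
  have h₂ : weight δ = -(n' + j) - -m := not_not.1 fun h => hjδ (coeff_expXi_of_ne h)
  have h₃ := weight_mono hγ
  have h₄ := weight_mono hδ
  have h₅ : a ≤ i := not_lt.1 fun h => hi (hA i n h)
  have h₆ : j ≤ b := not_lt.1 fun h => hj (hB j n' h)
  rw [Set.mem_Icc]
  lia

/-- At `t = 0` only one site contributes to a given power of `z`. -/
theorem coeff_zero_act {F : ZFun} {m p : ℤ}
    (hF : ∀ q, MvPowerSeries.constantCoeff (F q m) = if q = p then 1 else 0) (A : PDO) (n : ℤ) :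
    MvPowerSeries.coeff 0 (act A F n m) = MvPowerSeries.constantCoeff (A.coeff (p - n) n) := by
  have hJ : ∀ q ∉ ({p} : Finset ℤ), ∀ β ≤ (0 : ℕ+ →₀ ℕ),
      MvPowerSeries.coeff β (F q m) = 0 := fun q hq β hβ => by
    rw [nonpos_iff_eq_zero.1 hβ, MvPowerSeries.coeff_zero_eq_constantCoeff_apply, hF,
      if_neg (by simpa using hq)]
  rw [coeff_act hJ, Finset.sum_singleton, MvPowerSeries.coeff_zero_eq_constantCoeff_apply, map_mul,
    hF, if_pos rfl, mul_one]

/-- At `t = t' = 0` the residue is an entry of the operator product `A C`. -/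
theorem res_zero_zero {F G : ZFun} {A C : PDO}
    (hF : ∀ m q, MvPowerSeries.constantCoeff (F q m) = if q = m then 1 else 0)
    (hG : ∀ m q, MvPowerSeries.constantCoeff (G q m) = if q = -m then 1 else 0)
    (hfin : ∀ j n, (Function.support fun i => A.coeff i n * C.coeff (j - i) (n + i)).Finite)
    (n n' : ℤ) :
    res (act A F) (act C.adj G) n n' 0 0 =
      MvPowerSeries.constantCoeff ((A * C).coeff (n' - n) n) := by
  rw [coeff_mul, map_finsum _ (hfin _ _), res, ← finsum_comp_equiv (Equiv.addRight n)]
  refine finsum_congr fun i => ?_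
  rw [resTerm, Equiv.coe_addRight, coeff_zero_act (hF _), coeff_zero_act (hG _), map_mul, coeff_adj]
  congr 3 <;> ring

theorem support_finite_of_isDown {A B : PDO} (hA : A.IsDown) (hB : B.IsDown) (j n : ℤ) :
    (Function.support fun i => A.coeff i n * B.coeff (j - i) (n + i)).Finite := by
  obtain ⟨a, hA⟩ := hA
  obtain ⟨b, hB⟩ := hB
  refine (Set.finite_Icc (j - b) a).subset fun i hi => ?_
  have h₁ := not_lt.1 fun h => left_ne_zero_of_mul hi (hA i n h)
  have h₂ := not_lt.1 fun h => right_ne_zero_of_mul hi (hB (j - i) (n + i) h)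
  rw [Set.mem_Icc]
  lia

theorem support_finite_of_isUp {A B : PDO} (hA : A.IsUp) (hB : B.IsUp) (j n : ℤ) :
    (Function.support fun i => A.coeff i n * B.coeff (j - i) (n + i)).Finite := by
  obtain ⟨a, hA⟩ := hA
  obtain ⟨b, hB⟩ := hB
  refine (Set.finite_Icc a (j - b)).subset fun i hi => ?_
  have h₁ := not_lt.1 fun h => left_ne_zero_of_mul hi (hA i n h)
  have h₂ := not_lt.1 fun h => right_ne_zero_of_mul hi (hB (j - i) (n + i) h)
  rw [Set.mem_Icc]
  lia

theorem IsBanded.neg_adj {A : PDO} (h : IsBanded A) : IsBanded (-A.adj) :=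
  ⟨h.2.adj.neg, h.1.adj.neg⟩

theorem TodaFlow.bilinear {𝒯 : TodaObjects} {C₁ C₂ : PDO} {M : ℕ+ → PDO} (hT : 𝒯.HasTodaForm)
    (h : TodaFlow 𝒯.S₁ C₁ 𝒯.S₂ C₂ M) : 𝒯.Bilinear := by
  have hC₁ := h.inv₁.invDown_eq
  have hC₂ := h.inv₂.invUp_eq
  have hf₁ : ResFinite 𝒯.Psi₁ 𝒯.PsiAdj₁ := by
    rw [hT.Psi₁_eq, hT.PsiAdj₁_eq, hC₁]
    exact resFinite_expUp h.inv₁.1 h.inv₁.2.adj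
  have hf₂ : ResFinite 𝒯.Psi₂ 𝒯.PsiAdj₂ := by
    rw [hT.Psi₂_eq, hT.PsiAdj₂_eq, hC₂]
    exact resFinite_expDown h.inv₂.1 h.inv₂.2.adj
  have hP₁ : ∀ k, ZFun.pd k 𝒯.Psi₁ = act (M k) 𝒯.Psi₁ := fun k => by
    rw [hT.Psi₁_eq]
    exact pd_act_of_flow (h.banded k) (locFin_expUp 1) (pd_expUp k) (h.flow₁ k)
  have hP₂ : ∀ k, ZFun.pd k 𝒯.Psi₂ = act (M k) 𝒯.Psi₂ := fun k => by
    rw [hT.Psi₂_eq]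
    exact pd_act_of_flow_neg (h.banded k) (locFin_expDown (-1)) (pd_expDown k) (h.flow₂ k)
  have hQ₁ : ∀ k, ZFun.pd k 𝒯.PsiAdj₁ = act (-(M k).adj) 𝒯.PsiAdj₁ := fun k => by
    rw [hT.PsiAdj₁_eq, hC₁]
    exact pd_act_of_flow_neg (h.banded k).neg_adj (locFin_expDownNeg (-1)) (pd_expDownNeg k)
      (h.adj_pd_inv₁ k)
  have hQ₂ : ∀ k, ZFun.pd k 𝒯.PsiAdj₂ = act (-(M k).adj) 𝒯.PsiAdj₂ := fun k => by
    rw [hT.PsiAdj₂_eq, hC₂]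
    exact pd_act_of_flow (h.banded k).neg_adj (locFin_expUpNeg 1) (pd_expUpNeg k) (h.adj_pd_inv₂ k)
  have h₀ : ∀ n n', res 𝒯.Psi₁ 𝒯.PsiAdj₁ n n' 0 0 = res 𝒯.Psi₂ 𝒯.PsiAdj₂ n n' 0 0 := by
    intro n n'
    rw [hT.Psi₁_eq, hT.PsiAdj₁_eq, hT.Psi₂_eq, hT.PsiAdj₂_eq, hC₁, hC₂,
      res_zero_zero _ _ (support_finite_of_isDown h.inv₁.1 h.inv₁.2),
      res_zero_zero _ _ (support_finite_of_isUp h.inv₂.1 h.inv₂.2), h.inv₁.3, h.inv₂.3]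
    all_goals
      intro m q
      first | rw [expUp] | rw [expDownNeg] | rw [expDown] | rw [expUpNeg]
      rw [constantCoeff_expXi]
      exact if_congr (by lia) rfl rfl
  intro n n' α β
  refine ⟨hf₁ n n' α β, hf₂ n n' α β, ?_⟩
  -- agreement at `t = t' = 0` spreads first in `t`, then, by symmetry of the residue, in `t'`
  have h₁ : ∀ α n n', res 𝒯.Psi₁ 𝒯.PsiAdj₁ n n' α 0 = res 𝒯.Psi₂ 𝒯.PsiAdj₂ n n' α 0 :=
    res_eq_of_flow h.banded hP₁ hP₂ hf₁ hf₂ h₀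
  rw [res_symm, res_symm 𝒯.Psi₂]
  exact res_eq_of_flow (fun k => (h.banded k).neg_adj) hQ₁ hQ₂ hf₁.symm hf₂.symm
    (fun n n' => by rw [res_symm, res_symm 𝒯.PsiAdj₂]; exact h₁ α n' n) β n' n

/-! ### Difference operators -/

namespace IsBanded

variable {A B : PDO}

theorem add (hA : IsBanded A) (hB : IsBanded B) : IsBanded (A + B) :=
  ⟨hA.1.add hB.1, hA.2.add hB.2⟩
theorem sub (hA : IsBanded A) (hB : IsBanded B) : IsBanded (A - B) :=
  ⟨hA.1.sub hB.1, hA.2.sub hB.2⟩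
theorem mul (hA : IsBanded A) (hB : IsBanded B) : IsBanded (A * B) :=
  ⟨hA.1.mul hB.1, hA.2.mul hB.2⟩
theorem pd (k : ℕ+) (hA : IsBanded A) : IsBanded (PDO.pd k A) := ⟨hA.1.pd k, hA.2.pd k⟩

end IsBanded

theorem isBanded_shift (k : ℤ) : IsBanded (shift k) := ⟨isDown_shift k, isUp_shift k⟩
theorem isBanded_one : IsBanded 1 := isBanded_shift 0
theorem isBanded_ofFun (f : ℤ → TimeSeries) : IsBanded (ofFun f) := ⟨isDown_ofFun f, isUp_ofFun f⟩
theorem isBanded_lamSub : IsBanded lamSub := ⟨isDown_lamSub, isUp_lamSub⟩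
theorem isBanded_delta : IsBanded delta := (isBanded_shift 1).sub isBanded_one

theorem isBanded_ge {A : PDO} (hA : A.IsDown) : IsBanded (ge 0 A) := by
  obtain ⟨N, hN⟩ := hA
  exact ⟨⟨N, fun j n hj => by rw [coeff_ge, hN j n hj, ite_self]⟩,
    ⟨0, fun j n hj => by rw [coeff_ge, if_neg (not_le.2 hj)]⟩⟩

theorem isBanded_lt {A : PDO} (hA : A.IsUp) : IsBanded (lt 0 A) := by
  obtain ⟨N, hN⟩ := hA
  exact ⟨⟨0, fun j n hj => by rw [coeff_lt, if_neg (not_lt.2 hj.le)]⟩,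
    ⟨N, fun j n hj => by rw [coeff_lt, hN j n hj, ite_self]⟩⟩

/-- The cofactor `1 + Λ⁻¹` of `Δ` in `Λ - Λ⁻¹`. -/
def cofactor : PDO := 1 + shift (-1)

theorem isBanded_cofactor : IsBanded cofactor := isBanded_one.add (isBanded_shift (-1))

theorem adj_cofactor : cofactor.adj = shift 1 + 1 := by
  rw [cofactor, adj_add, adj_one, adj_shift, neg_neg, add_comm]

theorem cofactor_mul_delta : cofactor * delta = lamSub := by
  let p : DownOp := ⟨shift 1, isDown_shift 1⟩
  let q : DownOp := ⟨shift (-1), isDown_shift (-1)⟩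
  have hqp : q * p = 1 := DownOp.ext (isDownInv_shift 1).4
  have h : (1 + q) * (p - 1) = p - q := by
    rw [add_mul, one_mul, mul_sub, hqp, mul_one]; abel
  exact congrArg DownOp.val h

theorem delta_mul_cofactor : delta * cofactor = lamSub := by
  let p : DownOp := ⟨shift 1, isDown_shift 1⟩
  let q : DownOp := ⟨shift (-1), isDown_shift (-1)⟩
  have hpq : p * q = 1 := DownOp.ext (isDownInv_shift 1).3
  have h : (p - 1) * (1 + q) = p - q := by
    rw [sub_mul, one_mul, mul_add, hpq, mul_one]; abel
  exact congrArg DownOp.val h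

/-- If `u d = d u = l` and `l` has the inverse `i`, then `d` has the inverse `u i`. -/
theorem inv_of_commuting_factor {R : Type*} [Monoid R] {u d l i : R} (hud : u * d = l)
    (hdu : d * u = l) (hli : l * i = 1) (hil : i * l = 1) :
    d * (u * i) = 1 ∧ u * i * d = 1 := by
  have hcomm : d * l = l * d := by rw [← hdu, mul_assoc, hud, ← hdu]
  refine ⟨by rw [← mul_assoc, hdu, hli], ?_⟩
  calc u * i * d = u * i * (d * l) * i := by simp only [mul_assoc, hli, mul_one]
    _ = u * (i * l) * d * i := by rw [hcomm]; simp only [mul_assoc]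
    _ = 1 := by rw [hil, mul_one, hud, hli]

theorem isDownInv_delta : IsDownInv delta (cofactor * lamInv) := by
  have hu := isBanded_cofactor.1
  have hi := isDownInv_lamSub.2
  obtain ⟨h₁, h₂⟩ := inv_of_commuting_factor (R := DownOp) (u := ⟨cofactor, hu⟩)
    (d := ⟨delta, isBanded_delta.1⟩) (l := ⟨lamSub, isDown_lamSub⟩) (i := ⟨lamInv, hi⟩)
    (DownOp.ext cofactor_mul_delta) (DownOp.ext delta_mul_cofactor)
    (DownOp.ext isDownInv_lamSub.3) (DownOp.ext isDownInv_lamSub.4)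
  exact ⟨isBanded_delta.1, hu.mul hi, congrArg DownOp.val h₁, congrArg DownOp.val h₂⟩

theorem isUpInv_delta : IsUpInv delta (cofactor * -lamInv.adj) := by
  have hu := isBanded_cofactor.2
  have hi := isUpInv_lamSub.2
  obtain ⟨h₁, h₂⟩ := inv_of_commuting_factor (R := UpOp) (u := ⟨cofactor, hu⟩)
    (d := ⟨delta, isBanded_delta.2⟩) (l := ⟨lamSub, isUp_lamSub⟩) (i := ⟨_, hi⟩)
    (UpOp.ext cofactor_mul_delta) (UpOp.ext delta_mul_cofactor)
    (UpOp.ext isUpInv_lamSub.3) (UpOp.ext isUpInv_lamSub.4)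
  exact ⟨isBanded_delta.2, hu.mul hi, congrArg UpOp.val h₁, congrArg UpOp.val h₂⟩

/-! ### Wave operators of the large BKP hierarchy -/

namespace IsWavePair

variable {Sp Sm : PDO}

/-- The coefficient of `Λ⁻¹` in the constraint. -/
theorem b0_mul (h : IsWavePair Sp Sm) (n : ℤ) : b0 Sp (n + 1) * Sm.coeff 0 n = 1 := by
  have h₁ : OrderLE (-1) (Sp * shift (-1)) := by
    simpa using OrderLE.mul (a := 0) h.plus_form (orderLE_shift (-1))
  have h₂ := h₁.coeff_mul_lead (b := 0) h.minus_form (n + 1)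
  rw [h.constraint, isDownInv_lamSub.invDown_eq, coeff_mul_shift, add_neg_cancel_right,
    add_zero, sub_self] at h₂
  rw [b0, ← h₂]
  exact lamInv_coeff_neg_one (n + 1)

theorem isUnit_b0 (h : IsWavePair Sp Sm) (n : ℤ) : IsUnit (b0 Sp n) := by
  have := h.b0_mul (n - 1)
  rw [sub_add_cancel] at this
  exact IsUnit.of_mul_eq_one _ this

theorem b0_mul_inv (h : IsWavePair Sp Sm) (n : ℤ) : b0 Sp n * (b0 Sp n)⁻¹ = 1 :=
  MvPowerSeries.mul_inv_cancel _ (MvPowerSeries.isUnit_iff_constantCoeff.1 (h.isUnit_b0 n)).ne_zero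

theorem inv_mul_b0 (h : IsWavePair Sp Sm) (n : ℤ) : (b0 Sp n)⁻¹ * b0 Sp n = 1 := by
  rw [mul_comm, h.b0_mul_inv]

theorem isUnit_minus (h : IsWavePair Sp Sm) (n : ℤ) : IsUnit (Sm.coeff 0 n) :=
  IsUnit.of_mul_eq_one_right _ (h.b0_mul n)

theorem isDown_plus (h : IsWavePair Sp Sm) : Sp.IsDown := ⟨0, h.plus_form⟩
theorem isDown_minus (h : IsWavePair Sp Sm) : Sm.IsDown := ⟨0, h.minus_form⟩

/-- The constraint gives `(S⁺)⁻¹ = Λ⁻¹ S⁻ (Λ - Λ⁻¹)`. -/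
theorem inv_plus (h : IsWavePair Sp Sm) : IsDownInv Sp (shift (-1) * Sm * lamSub) := by
  let a : DownOp := ⟨Sp, h.isDown_plus⟩
  let b : DownOp := ⟨Sm, h.isDown_minus⟩
  let q : DownOp := ⟨shift (-1), isDown_shift (-1)⟩
  let l : DownOp := ⟨lamSub, isDown_lamSub⟩
  let i : DownOp := ⟨lamInv, isDownInv_lamSub.right_isDown⟩
  have hi : a * q * b = i := DownOp.ext (h.constraint.trans isDownInv_lamSub.invDown_eq)
  have hil : i * l = 1 := DownOp.ext isDownInv_lamSub.4
  have h₁ : a * (q * b * l) = 1 := by rw [← mul_assoc, ← mul_assoc, hi, hil]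
  exact isDownInv_of_mul_eq_one h.plus_form h.isUnit_b0 (q * b * l).prop (congrArg DownOp.val h₁)

/-- The constraint gives `(S⁻)⁻¹ = (Λ - Λ⁻¹) S⁺ Λ⁻¹`. -/
theorem inv_minus (h : IsWavePair Sp Sm) : IsDownInv Sm (lamSub * Sp * shift (-1)) := by
  let a : DownOp := ⟨Sp, h.isDown_plus⟩
  let b : DownOp := ⟨Sm, h.isDown_minus⟩
  let p : DownOp := ⟨shift 1, isDown_shift 1⟩
  let q : DownOp := ⟨shift (-1), isDown_shift (-1)⟩
  let l : DownOp := ⟨lamSub, isDown_lamSub⟩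
  let i : DownOp := ⟨lamInv, isDownInv_lamSub.right_isDown⟩
  have hi : a * q * b = i := DownOp.ext (h.constraint.trans isDownInv_lamSub.invDown_eq)
  have hli : l * i = 1 := DownOp.ext isDownInv_lamSub.3
  have hpq : p * q = 1 := DownOp.ext (isDownInv_shift 1).3
  have hba : q * b * l * a = 1 := DownOp.ext h.inv_plus.4
  have h₁ : b * (l * a * q) = 1 := by
    calc b * (l * a * q) = p * q * (b * (l * a * q)) := by rw [hpq, one_mul]
      _ = p * (q * b * l * a) * q := by simp only [mul_assoc]
      _ = 1 := by rw [hba, mul_one, hpq]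
  have h₂ : l * a * q * b = 1 := by
    rw [mul_assoc l, mul_assoc l, hi, hli]
  exact ⟨b.prop, (l * a * q).prop, congrArg DownOp.val h₁, congrArg DownOp.val h₂⟩

end IsWavePair

/-! ### Dressed flows -/

/-- A gauge transformation `T` with `M T = T B + ∂T` turns the flow of `s` generated by `B` into
one generated by `M`. -/
theorem gauge_flow {R : Type*} [Ring R] {T dT M B s ds q : R} (hM : M * T = T * B + dT)
    (hds : ds = B * s - s * q) : dT * s + T * ds = M * (T * s) - T * s * q := by
  rw [← mul_assoc M, hM, hds]; noncomm_ring

theorem gauge_flow_plus {Sp Sm T M : PDO} {k : ℕ+} (h : IsWavePair Sp Sm) (hT : IsBanded T)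
    (hM : IsBanded M) (hB : IsBanded (bkpB Sp Sm k)) (hMT : M * T = T * bkpB Sp Sm k + pd k T) :
    pd k (T * Sp) = M * (T * Sp) - T * Sp * shift ((k : ℕ) : ℤ) := by
  rw [pd_mul_of_isDown k hT.1 h.isDown_plus]
  exact congrArg DownOp.val (gauge_flow (R := DownOp) (T := ⟨T, hT.1⟩)
    (dT := ⟨pd k T, hT.1.pd k⟩) (M := ⟨M, hM.1⟩) (B := ⟨_, hB.1⟩) (s := ⟨Sp, h.isDown_plus⟩)
    (ds := ⟨pd k Sp, h.isDown_plus.pd k⟩) (q := ⟨_, isDown_shift ((k : ℕ) : ℤ)⟩)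
    (DownOp.ext hMT) (DownOp.ext (h.flow_plus k)))

theorem gauge_flow_minus {Sp Sm T M : PDO} {k : ℕ+} (h : IsWavePair Sp Sm) (hT : IsBanded T)
    (hM : IsBanded M) (hB : IsBanded (bkpB Sp Sm k)) (hMT : M * T = T * bkpB Sp Sm k + pd k T) :
    pd k (T * Sm.adj) = M * (T * Sm.adj) + T * Sm.adj * shift (-((k : ℕ) : ℤ)) := by
  have hm := h.isDown_minus.adj
  rw [pd_mul_of_isUp k hT.2 hm]
  have hf : pd k Sm.adj = bkpB Sp Sm k * Sm.adj + Sm.adj * shift (-((k : ℕ) : ℤ)) := by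
    rw [← adj_pd, h.flow_minus k, adj_add, adj_mul, adj_mul, adj_adj, adj_shift, add_comm]
  let q : UpOp := ⟨_, isUp_shift (-((k : ℕ) : ℤ))⟩
  let s : UpOp := ⟨Sm.adj, hm⟩
  let B : UpOp := ⟨_, hB.2⟩
  let ds : UpOp := ⟨pd k Sm.adj, hm.pd k⟩
  let t : UpOp := ⟨T, hT.2⟩
  let dt : UpOp := ⟨pd k T, hT.2.pd k⟩
  let m : UpOp := ⟨M, hM.2⟩
  have hds : ds = B * s - s * -q := by
    rw [mul_neg, sub_neg_eq_add]; exact UpOp.ext hf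
  have hmt : m * t = t * B + dt := UpOp.ext hMT
  have key : dt * s + t * ds = m * (t * s) + t * s * q := by
    rw [gauge_flow hmt hds, mul_neg, sub_neg_eq_add]
  exact congrArg UpOp.val key

theorem isBanded_bkpB_factor {Sp Sm : PDO} (h : IsWavePair Sp Sm) (k : ℕ+) :
    ∃ C, IsBanded C ∧ bkpB Sp Sm k = C * lamSub := by
  have hA := (h.isDown_plus.mul (isDown_shift (((k : ℕ) : ℤ) - 1))).mul h.isDown_minus
  exact ⟨_, (isBanded_ge hA).add (isBanded_lt hA.adj), rfl⟩

theorem isBanded_bkpB {Sp Sm : PDO} (h : IsWavePair Sp Sm) (k : ℕ+) :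
    IsBanded (bkpB Sp Sm k) := by
  obtain ⟨C, hC, hB⟩ := isBanded_bkpB_factor h k
  rw [hB]
  exact hC.mul isBanded_lamSub

/-! ### Form of the Lax operators -/

theorem lax_form_down {S C L : PDO} (hS : OrderLE 0 S) (hlead : ∀ n, S.coeff 0 n = 1)
    (h : IsDownInv S C) (hL : L = S * shift 1 * C) :
    OrderLE 1 L ∧ ∀ n, L.coeff 1 n = 1 := by
  have hC := OrderLE.of_isDownInv hS (fun n => by rw [hlead n]; exact isUnit_one) h
  have hL₁ : OrderLE 1 L := by
    rw [hL]; simpa using (hS.mul (orderLE_shift 1)).mul hC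
  refine ⟨hL₁, fun n => ?_⟩
  have hLS : L * S = S * shift 1 := by
    rw [hL, IsDown.mul_assoc (h.1.mul (isDown_shift 1)) h.2 h.1, h.4, PDO.mul_one]
  have h₁ := hL₁.coeff_mul_lead hS n
  rwa [hLS, coeff_mul_shift, add_zero, sub_self, hlead, hlead, mul_one, eq_comm] at h₁

theorem lax_form_up {S C L : PDO} (hS : OrderGE 0 S) (hlead : ∀ n, IsUnit (S.coeff 0 n))
    (h : IsUpInv S C) (hL : L = S * shift (-1) * C) :
    OrderGE (-1) L ∧ ∀ n, IsUnit (L.coeff (-1) n) := by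
  have hC := OrderGE.of_isUpInv hS hlead h
  have hL₁ : OrderGE (-1) L := by
    rw [hL]; simpa using (hS.mul (orderGE_shift (-1))).mul hC
  refine ⟨hL₁, fun n => ?_⟩
  have hLS : L * S = S * shift (-1) := by
    rw [hL, IsUp.mul_assoc (h.1.mul (isUp_shift (-1))) h.2 h.1, h.4, PDO.mul_one]
  have h₁ := hL₁.coeff_mul_lead hS n
  rw [hLS, coeff_mul_shift, add_zero, sub_self] at h₁
  exact isUnit_of_mul_isUnit_left (h₁ ▸ hlead n)

/-! ### Exponentials at shifted sites -/

theorem zmul_expDownNeg (ε : ℂ) :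
    zmul (-1) (expDownNeg ε) = fun n => expDownNeg ε (n + 1) := by
  funext n m
  change expXi ε _ = expXi ε _
  congr 1; ring

theorem zmul_zinv_expUp (ε : ℂ) : zmul 1 (zinv (expUp ε)) = fun n => expUpNeg ε (n + -1) := by
  funext n m
  change expXi ε _ = expXi ε _
  congr 1; ring

theorem zmul_zinv_zmul_expDownNeg (ε : ℂ) :
    zmul (-1) (zinv (zmul (-1) (expDownNeg ε))) = expDown ε := by
  funext n m
  change expXi ε _ = expXi ε _
  congr 1; ring

theorem zmul_expUp (ε : ℂ) : zmul (-1) (expUp ε) = fun n => expUp ε (n + -1) := by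
  funext n m
  change expXi ε _ = expXi ε _
  congr 1; ring

theorem zmul_zmul_expDownNeg (ε : ℂ) : zmul 1 (zmul (-1) (expDownNeg ε)) = expDownNeg ε := by
  funext n m
  change expXi ε _ = expXi ε _
  congr 1; ring

/-! ### The Miura transformation `T₁ = b₀(n)⁻¹` -/

section CaseI

variable {Sp Sm : PDO}

theorem isBanded_miuraT₁ (Sp : PDO) : IsBanded (miuraT₁ Sp) := isBanded_ofFun _
theorem isBanded_miuraT₁Inv (Sp : PDO) : IsBanded (miuraT₁Inv Sp) := isBanded_ofFun _

theorem isDownInv_miuraT₁ (h : IsWavePair Sp Sm) : IsDownInv (miuraT₁ Sp) (miuraT₁Inv Sp) :=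
  isDownInv_ofFun h.inv_mul_b0
theorem isUpInv_miuraT₁ (h : IsWavePair Sp Sm) : IsUpInv (miuraT₁ Sp) (miuraT₁Inv Sp) :=
  isUpInv_ofFun h.inv_mul_b0

theorem miura₁_inv₁ (h : IsWavePair Sp Sm) : IsDownInv (miura₁ Sp Sm).S₁
    (shift (-1) * Sm * lamSub * miuraT₁Inv Sp) :=
  (isDownInv_miuraT₁ h).mul h.inv_plus

theorem miura₁_inv₂ (h : IsWavePair Sp Sm) : IsUpInv (miura₁ Sp Sm).S₂
    ((lamSub * Sp * shift (-1)).adj * miuraT₁Inv Sp) :=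
  (isUpInv_miuraT₁ h).mul h.inv_minus.adj

theorem miura₁_hasTodaForm (h : IsWavePair Sp Sm) : (miura₁ Sp Sm).HasTodaForm := by
  have hinv₁ := miura₁_inv₁ h
  have hinv₂ := miura₁_inv₂ h
  have hT := isBanded_miuraT₁ Sp
  have hTi := isBanded_miuraT₁Inv Sp
  have hp := h.isDown_plus
  have hm := h.isDown_minus.adj
  have hS₁ : OrderLE 0 (miura₁ Sp Sm).S₁ := by
    have := (orderLE_ofFun fun n => (b0 Sp n)⁻¹).mul (b := 0) h.plus_form
    rwa [add_zero] at this
  have hS₂ : OrderGE 0 (miura₁ Sp Sm).S₂ := by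
    have := (orderGE_ofFun fun n => (b0 Sp n)⁻¹).mul (OrderLE.adj (N := 0) h.minus_form)
    rwa [neg_zero, add_zero] at this
  have hlead₁ : ∀ n, (miura₁ Sp Sm).S₁.coeff 0 n = 1 := fun n =>
    (coeff_ofFun_mul _ _ _ _).trans (h.inv_mul_b0 n)
  have hlead₂ : ∀ n, IsUnit ((miura₁ Sp Sm).S₂.coeff 0 n) := fun n => by
    have h₁ : (miura₁ Sp Sm).S₂.coeff 0 n = (b0 Sp n)⁻¹ * Sm.adj.coeff 0 n :=
      coeff_ofFun_mul _ _ _ _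
    rw [h₁, coeff_adj, neg_zero, add_zero]
    exact (IsUnit.of_mul_eq_one _ (h.inv_mul_b0 n)).mul (h.isUnit_minus n)
  have hd₁ : (miura₁ Sp Sm).L₁ =
      (miura₁ Sp Sm).S₁ * shift 1 * invDown (miura₁ Sp Sm).S₁ := by
    rw [hinv₁.invDown_eq]
    change miuraT₁ Sp * (Sp * shift 1 * invDown Sp) * miuraT₁Inv Sp = _
    rw [h.inv_plus.invDown_eq]
    let t : DownOp := ⟨miuraT₁ Sp, hT.1⟩
    let ti : DownOp := ⟨miuraT₁Inv Sp, hTi.1⟩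
    let a : DownOp := ⟨Sp, hp⟩
    let p : DownOp := ⟨shift 1, isDown_shift 1⟩
    let c : DownOp := ⟨_, h.inv_plus.2⟩
    exact congrArg DownOp.val
      (show t * (a * p * c) * ti = t * a * p * (c * ti) by simp only [mul_assoc])
  have hd₂ : (miura₁ Sp Sm).L₂ =
      (miura₁ Sp Sm).S₂ * shift (-1) * invUp (miura₁ Sp Sm).S₂ := by
    rw [hinv₂.invUp_eq]
    change miuraT₁ Sp * (Sm.adj * shift (-1) * invUp Sm.adj) * miuraT₁Inv Sp = _
    rw [h.inv_minus.adj.invUp_eq]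
    let t : UpOp := ⟨miuraT₁ Sp, hT.2⟩
    let ti : UpOp := ⟨miuraT₁Inv Sp, hTi.2⟩
    let a : UpOp := ⟨Sm.adj, hm⟩
    let q : UpOp := ⟨shift (-1), isUp_shift (-1)⟩
    let c : UpOp := ⟨_, h.inv_minus.adj.2⟩
    exact congrArg UpOp.val
      (show t * (a * q * c) * ti = t * a * q * (c * ti) by simp only [mul_assoc])
  have hL₁ := lax_form_down hS₁ hlead₁ hinv₁ (hinv₁.invDown_eq ▸ hd₁)
  have hL₂ := lax_form_up hS₂ hlead₂ hinv₂ (hinv₂.invUp_eq ▸ hd₂)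
  have hsub : shift (-1) - shift 1 = -lamSub := by rw [lamSub, neg_sub]
  refine ⟨hS₁, hlead₁, hS₂, hlead₂, hL₁.1, hL₁.2, hL₂.1, hL₂.2, hd₁, hd₂, ?_, ?_, ?_, ?_⟩
  · exact (act_mul hT Sp (locFin_expUp 1)).symm
  · change act (miuraT₁ Sp) (act Sm.adj (zmul (-1) (zinv (zmul (-1) (expDownNeg (-1)))))) = _
    rw [zmul_zinv_zmul_expDownNeg, ← act_mul hT _ (locFin_expDown _)]
    rfl
  · change act (miuraT₁Inv Sp * (shift (-1) - shift 1))
      (act Sm.adj (zmul (-1) (expDownNeg (-1)))) = _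
    rw [zmul_expDownNeg, ← act_mul_shift, hsub,
      ← act_mul (hTi.mul ⟨isDown_lamSub.neg, isUp_lamSub.neg⟩) _ (locFin_expDownNeg _),
      hinv₁.invDown_eq]
    congr 1
    have e : (shift (-1) * Sm * lamSub * miuraT₁Inv Sp).adj =
        miuraT₁Inv Sp * (-lamSub * (Sm.adj * shift 1)) := by
      simp only [adj_mul, adj_lamSub, adj_shift, neg_neg, miuraT₁Inv, adj_ofFun]
    rw [e]
    exact IsUp.mul_assoc hTi.2 isUp_lamSub.neg (hm.mul (isUp_shift 1))
  · change -act (miuraT₁Inv Sp * (shift (-1) - shift 1)) (act Sp (zmul 1 (zinv (expUp 1)))) = _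
    rw [zmul_zinv_expUp, ← act_mul_shift, hsub,
      ← act_mul (hTi.mul ⟨isDown_lamSub.neg, isUp_lamSub.neg⟩) _ (locFin_expUpNeg _),
      hinv₂.invUp_eq, ← act_neg]
    congr 1
    have e : ((lamSub * Sp * shift (-1)).adj * miuraT₁Inv Sp).adj =
        miuraT₁Inv Sp * (lamSub * Sp * shift (-1)) := by
      rw [adj_mul, adj_adj, miuraT₁Inv, adj_ofFun]
    rw [e]
    let ti : DownOp := ⟨miuraT₁Inv Sp, hTi.1⟩
    let l : DownOp := ⟨lamSub, isDown_lamSub⟩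
    let a : DownOp := ⟨Sp, hp⟩
    let q : DownOp := ⟨shift (-1), isDown_shift (-1)⟩
    exact congrArg DownOp.val (show -(ti * -l * (a * q)) = ti * (l * a * q) by noncomm_ring)

theorem miura₁_todaFlow (h : IsWavePair Sp Sm) :
    TodaFlow (miura₁ Sp Sm).S₁ (shift (-1) * Sm * lamSub * miuraT₁Inv Sp) (miura₁ Sp Sm).S₂
      ((lamSub * Sp * shift (-1)).adj * miuraT₁Inv Sp)
      (fun k => miuraT₁ Sp * bkpB Sp Sm k * miuraT₁Inv Sp +
        pd k (miuraT₁ Sp) * miuraT₁Inv Sp) := by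
  have hT := isBanded_miuraT₁ Sp
  have hTi := isBanded_miuraT₁Inv Sp
  have hM : ∀ k, IsBanded (miuraT₁ Sp * bkpB Sp Sm k * miuraT₁Inv Sp +
      pd k (miuraT₁ Sp) * miuraT₁Inv Sp) := fun k =>
    ((hT.mul (isBanded_bkpB h k)).mul hTi).add ((hT.pd k).mul hTi)
  have hMT : ∀ k, (miuraT₁ Sp * bkpB Sp Sm k * miuraT₁Inv Sp +
      pd k (miuraT₁ Sp) * miuraT₁Inv Sp) * miuraT₁ Sp =
      miuraT₁ Sp * bkpB Sp Sm k + pd k (miuraT₁ Sp) := fun k => by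
    let t : DownOp := ⟨miuraT₁ Sp, hT.1⟩
    let ti : DownOp := ⟨miuraT₁Inv Sp, hTi.1⟩
    let B : DownOp := ⟨_, (isBanded_bkpB h k).1⟩
    let dt : DownOp := ⟨_, hT.1.pd k⟩
    have hti : ti * t = 1 := DownOp.ext (isDownInv_miuraT₁ h).4
    have key : (t * B * ti + dt * ti) * t = t * B + dt := by
      rw [add_mul, mul_assoc, hti, mul_assoc dt, hti, mul_one, mul_one]
    exact congrArg DownOp.val key
  exact ⟨miura₁_inv₁ h, miura₁_inv₂ h, hM,
    fun k => gauge_flow_plus h hT (hM k) (isBanded_bkpB h k) (hMT k),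
    fun k => gauge_flow_minus h hT (hM k) (isBanded_bkpB h k) (hMT k)⟩

/-- `Γ₁ = T₁⁻¹ Λ T₁⁻¹`, because `b₀(n+1) \bar b₀(n) = 1`. -/
theorem gamma₁_eq (h : IsWavePair Sp Sm) :
    (miura₁ Sp Sm).gamma₁ = miuraT₁Inv Sp * shift 1 * miuraT₁Inv Sp := by
  ext1; funext j n
  have h₁ : (miura₁ Sp Sm).S₂.coeff 0 n = (b0 Sp n)⁻¹ * Sm.coeff 0 n := by
    have : (miura₁ Sp Sm).S₂.coeff 0 n = (b0 Sp n)⁻¹ * Sm.adj.coeff 0 n :=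
      coeff_ofFun_mul _ _ _ _
    rwa [coeff_adj, neg_zero, add_zero] at this
  have h₂ : ((miura₁ Sp Sm).S₂.coeff 0 n)⁻¹ = b0 Sp n * b0 Sp (n + 1) := by
    have h₃ : b0 Sp n * b0 Sp (n + 1) * (miura₁ Sp Sm).S₂.coeff 0 n = 1 := by
      calc _ = b0 Sp n * (b0 Sp n)⁻¹ * (b0 Sp (n + 1) * Sm.coeff 0 n) := by rw [h₁]; ring
        _ = 1 := by rw [h.b0_mul_inv, h.b0_mul, one_mul]
    refine (MvPowerSeries.inv_eq_iff_mul_eq_one ?_).2 h₃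
    exact (MvPowerSeries.isUnit_iff_constantCoeff.1
      (IsUnit.of_mul_eq_one_right _ h₃)).ne_zero
  rw [TodaObjects.gamma₁, coeff_ofFun_mul, h₂, miuraT₁Inv, coeff_mul_ofFun, coeff_mul_shift,
    coeff_ofFun, coeff_shift]
  by_cases hj : j = 1
  · subst hj; simp
  · rw [if_neg hj, if_neg (by lia), mul_zero, zero_mul]

/-- If `S₂ Λ S₁^*` is minus the inverse of `G`, then `G` intertwines `L₂ = S₂ Λ⁻¹ S₂⁻¹` with the
adjoint of `L₁ = S₁ Λ S₁⁻¹`, because `G = -(S₁^*)⁻¹ Λ⁻¹ S₂⁻¹`. -/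
theorem adj_lax_mul_eq {S₁ C₁ S₂ C₂ G : PDO} (h₁ : IsDownInv S₁ C₁) (h₂ : IsUpInv S₂ C₂)
    (hG : IsUpInv G (-(S₂ * shift 1 * S₁.adj))) :
    (S₁ * shift 1 * C₁).adj * G = G * (S₂ * shift (-1) * C₂) := by
  rw [adj_mul, adj_mul, adj_shift]
  let g : UpOp := ⟨G, hG.1⟩
  let p : UpOp := ⟨shift 1, isUp_shift 1⟩
  let q : UpOp := ⟨shift (-1), isUp_shift (-1)⟩
  let s₁ : UpOp := ⟨S₁.adj, h₁.1.adj⟩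
  let c₁ : UpOp := ⟨C₁.adj, h₁.2.adj⟩
  let s₂ : UpOp := ⟨S₂, h₂.1⟩
  let c₂ : UpOp := ⟨C₂, h₂.2⟩
  have hg : g * -(s₂ * p * s₁) = 1 := UpOp.ext hG.3
  have hs₁ : s₁ * c₁ = 1 := UpOp.ext h₁.adj.3
  have hs₂ : s₂ * c₂ = 1 := UpOp.ext h₂.3
  have hc₂ : c₂ * s₂ = 1 := UpOp.ext h₂.4
  have hpq : p * q = 1 := UpOp.ext (isUpInv_shift 1).3
  have e : g = -(c₁ * q * c₂) := by
    calc g = g * (s₂ * (p * (s₁ * c₁) * q) * c₂) := by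
          rw [hs₁, mul_one, hpq, mul_one, hs₂, mul_one]
      _ = -(g * -(s₂ * p * s₁) * (c₁ * q * c₂)) := by noncomm_ring
      _ = -(c₁ * q * c₂) := by rw [hg, one_mul]
  have key : c₁ * (q * s₁) * g = g * (s₂ * q * c₂) := by
    calc c₁ * (q * s₁) * g = -(c₁ * q * (s₁ * c₁) * q * c₂) := by rw [e]; noncomm_ring
      _ = -(c₁ * q * (c₂ * s₂) * q * c₂) := by rw [hs₁, hc₂]
      _ = g * (s₂ * q * c₂) := by rw [e]; noncomm_ring
  exact congrArg UpOp.val key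

theorem miura₁_wave_constraint (h : IsWavePair Sp Sm) :
    (miura₁ Sp Sm).S₁ * shift (-1) * (miura₁ Sp Sm).S₂.adj =
      miuraT₁ Sp * invDown lamSub * (miuraT₁ Sp).adj := by
  have hT := isBanded_miuraT₁ Sp
  change miuraT₁ Sp * Sp * shift (-1) * (miuraT₁ Sp * Sm.adj).adj = _
  rw [← h.constraint, adj_mul, adj_adj]
  let t : DownOp := ⟨miuraT₁ Sp, hT.1⟩
  let t' : DownOp := ⟨(miuraT₁ Sp).adj, hT.2.adj⟩
  let a : DownOp := ⟨Sp, h.isDown_plus⟩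
  let b : DownOp := ⟨Sm, h.isDown_minus⟩
  let q : DownOp := ⟨shift (-1), isDown_shift (-1)⟩
  exact congrArg DownOp.val
    (show t * a * q * (b * t') = t * (a * q * b) * t' by simp only [mul_assoc])

theorem gamma₁_sub_adj (h : IsWavePair Sp Sm) :
    (miura₁ Sp Sm).gamma₁ - (miura₁ Sp Sm).gamma₁.adj =
      miuraT₁Inv Sp * lamSub * miuraT₁Inv Sp := by
  rw [gamma₁_eq h, adj_mul, adj_mul, adj_shift,
    show (miuraT₁Inv Sp).adj = miuraT₁Inv Sp from adj_ofFun _]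
  let ti : UpOp := ⟨miuraT₁Inv Sp, (isBanded_miuraT₁Inv Sp).2⟩
  let p : UpOp := ⟨shift 1, isUp_shift 1⟩
  let q : UpOp := ⟨shift (-1), isUp_shift (-1)⟩
  exact congrArg UpOp.val (show ti * p * ti - ti * (q * ti) = ti * (p - q) * ti by noncomm_ring)

theorem miura₁_constraint (h : IsWavePair Sp Sm) :
    Constraint₁ (miuraT₁ Sp) (miura₁ Sp Sm) := by
  have hinv₁ := miura₁_inv₁ h
  have hinv₂ := miura₁_inv₂ h
  have hform := miura₁_hasTodaForm h
  have hT := isUpInv_miuraT₁ h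
  refine ⟨miura₁_wave_constraint h, ?_⟩
  have hV : -((miura₁ Sp Sm).S₂ * shift 1 * (miura₁ Sp Sm).S₁.adj) =
      miuraT₁ Sp * (-lamInv.adj * miuraT₁ Sp) := by
    have h₁ := congrArg adj (miura₁_wave_constraint h)
    rw [isDownInv_lamSub.invDown_eq, adj_mul _ (PDO.adj _), adj_mul _ (shift (-1)), adj_adj,
      adj_shift, neg_neg, adj_mul _ (PDO.adj _), adj_mul _ lamInv, adj_adj,
      show (miuraT₁ Sp).adj = miuraT₁ Sp from adj_ofFun _] at h₁
    rw [IsUp.mul_assoc hinv₂.1 (isUp_shift 1) hinv₁.1.adj, h₁]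
    let t : UpOp := ⟨miuraT₁ Sp, hT.1⟩
    let i : UpOp := ⟨lamInv.adj, isDownInv_lamSub.right_isDown.adj⟩
    exact congrArg UpOp.val (show -(t * (i * t)) = t * (-i * t) by noncomm_ring)
  rw [hform.L₁_dressing, hform.L₂_dressing, hinv₁.invDown_eq, hinv₂.invUp_eq, gamma₁_sub_adj h]
  refine adj_lax_mul_eq hinv₁ hinv₂ ?_
  rw [hV]
  exact (hT.symm.mul isUpInv_lamSub).mul hT.symm

end CaseI

/-! ### The Miura transformation `T₂ = b₀(n+1)⁻¹ Δ` -/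

section CaseII

variable {Sp Sm : PDO}

/-- Multiplication by `b₀(n+1)`. -/
def b0Shift (Sp : PDO) : PDO := ofFun fun n => b0 Sp (n + 1)

/-- Multiplication by `b₀(n+1)⁻¹`. -/
def b0ShiftInv (Sp : PDO) : PDO := ofFun fun n => (b0 Sp (n + 1))⁻¹

theorem isBanded_b0Shift (Sp : PDO) : IsBanded (b0Shift Sp) := isBanded_ofFun _
theorem isBanded_b0ShiftInv (Sp : PDO) : IsBanded (b0ShiftInv Sp) := isBanded_ofFun _
theorem adj_b0Shift (Sp : PDO) : (b0Shift Sp).adj = b0Shift Sp := adj_ofFun _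
theorem isBanded_miuraT₂ (Sp : PDO) : IsBanded (miuraT₂ Sp) :=
  (isBanded_b0ShiftInv Sp).mul isBanded_delta

theorem isDownInv_b0ShiftInv (h : IsWavePair Sp Sm) :
    IsDownInv (b0ShiftInv Sp) (b0Shift Sp) :=
  isDownInv_ofFun fun n => h.inv_mul_b0 (n + 1)
theorem isUpInv_b0ShiftInv (h : IsWavePair Sp Sm) : IsUpInv (b0ShiftInv Sp) (b0Shift Sp) :=
  isUpInv_ofFun fun n => h.inv_mul_b0 (n + 1)

theorem isDownInv_miuraT₂ (h : IsWavePair Sp Sm) :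
    IsDownInv (miuraT₂ Sp) (cofactor * lamInv * b0Shift Sp) :=
  (isDownInv_b0ShiftInv h).mul isDownInv_delta
theorem isUpInv_miuraT₂ (h : IsWavePair Sp Sm) :
    IsUpInv (miuraT₂ Sp) (cofactor * -lamInv.adj * b0Shift Sp) :=
  (isUpInv_b0ShiftInv h).mul isUpInv_delta

/-- The factor `Δ` of `T₂` cancels against `Λ - Λ⁻¹` in `(S⁺)⁻¹`, which leaves
`𝒮₁⁻¹ = S⁻ (1 + Λ⁻¹) b₀(n+1)`. -/
theorem miura₂_inv₁ (h : IsWavePair Sp Sm) :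
    IsDownInv (miura₂ Sp Sm).S₁ (Sm * cofactor * b0Shift Sp) := by
  have h₀ : IsDownInv (miura₂ Sp Sm).S₁ (shift (- -1) *
      (shift (-1) * Sm * lamSub * (cofactor * lamInv * b0Shift Sp))) :=
    ((isDownInv_miuraT₂ h).mul h.inv_plus).mul (isDownInv_shift (-1))
  convert h₀ using 1
  let p : DownOp := ⟨shift (- -1), isDown_shift _⟩
  let q : DownOp := ⟨shift (-1), isDown_shift (-1)⟩
  let b : DownOp := ⟨Sm, h.isDown_minus⟩
  let l : DownOp := ⟨lamSub, isDown_lamSub⟩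
  let i : DownOp := ⟨lamInv, isDownInv_lamSub.right_isDown⟩
  let u : DownOp := ⟨cofactor, isBanded_cofactor.1⟩
  let d : DownOp := ⟨delta, isBanded_delta.1⟩
  let γ : DownOp := ⟨b0Shift Sp, (isBanded_b0Shift Sp).1⟩
  have hpq : p * q = 1 := DownOp.ext (isDownInv_shift (-1)).4
  have hl : u * d = l := DownOp.ext cofactor_mul_delta
  have hd : d * (u * i) = 1 := DownOp.ext isDownInv_delta.3
  have key : b * u * γ = p * (q * b * l * (u * i * γ)) := by
    calc b * u * γ = p * q * b * u * (d * (u * i)) * γ := by rw [hpq, hd, one_mul, mul_one]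
      _ = p * (q * b * (u * d) * (u * i * γ)) := by simp only [mul_assoc]
      _ = p * (q * b * l * (u * i * γ)) := by rw [hl]
  exact congrArg DownOp.val key

/-- As for `𝒮₁`: `𝒮₂⁻¹ = Λ (S⁺)^* (1 + Λ⁻¹) b₀(n+1)`. -/
theorem miura₂_inv₂ (h : IsWavePair Sp Sm) :
    IsUpInv (miura₂ Sp Sm).S₂ (shift 1 * Sp.adj * cofactor * b0Shift Sp) := by
  have h₀ : IsUpInv (miura₂ Sp Sm).S₂ (-((lamSub * Sp * shift (-1)).adj *
      (cofactor * -lamInv.adj * b0Shift Sp))) :=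
    ((isUpInv_miuraT₂ h).mul h.inv_minus.adj).neg
  convert h₀ using 1
  rw [adj_mul, adj_mul, adj_shift, adj_lamSub, neg_neg]
  let p : UpOp := ⟨shift 1, isUp_shift _⟩
  let a : UpOp := ⟨Sp.adj, h.isDown_plus.adj⟩
  let l : UpOp := ⟨lamSub, isUp_lamSub⟩
  let i : UpOp := ⟨-lamInv.adj, isUpInv_lamSub.right_isUp⟩
  let u : UpOp := ⟨cofactor, isBanded_cofactor.2⟩
  let d : UpOp := ⟨delta, isBanded_delta.2⟩
  let γ : UpOp := ⟨b0Shift Sp, (isBanded_b0Shift Sp).2⟩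
  have hl : u * d = l := UpOp.ext cofactor_mul_delta
  have hd : d * (u * i) = 1 := UpOp.ext isUpInv_delta.3
  have key : p * a * u * γ = -(p * (a * -l) * (u * i * γ)) := by
    calc p * a * u * γ = p * a * u * (d * (u * i)) * γ := by rw [hd, mul_one]
      _ = p * a * (u * d) * (u * i * γ) := by simp only [mul_assoc]
      _ = -(p * (a * -l) * (u * i * γ)) := by rw [hl]; noncomm_ring
  exact congrArg UpOp.val key

theorem coeff_miuraT₂ (Sp : PDO) (j n : ℤ) : (miuraT₂ Sp).coeff j n =
    (b0 Sp (n + 1))⁻¹ * ((if j = 1 then 1 else 0) - if j = 0 then 1 else 0) :=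
  coeff_ofFun_mul _ _ _ _

theorem orderLE_miuraT₂ (Sp : PDO) : OrderLE 1 (miuraT₂ Sp) := fun j n hj => by
  rw [coeff_miuraT₂, if_neg (by lia), if_neg (by lia), sub_zero, mul_zero]
theorem orderGE_miuraT₂ (Sp : PDO) : OrderGE 0 (miuraT₂ Sp) := fun j n hj => by
  rw [coeff_miuraT₂, if_neg (by lia), if_neg (by lia), sub_zero, mul_zero]

theorem miura₂_L₁_dressing (h : IsWavePair Sp Sm) : (miura₂ Sp Sm).L₁ =
    (miura₂ Sp Sm).S₁ * shift 1 * invDown (miura₂ Sp Sm).S₁ := by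
  have h₀ : IsDownInv (miura₂ Sp Sm).S₁ (shift (- -1) *
      (shift (-1) * Sm * lamSub * (cofactor * lamInv * b0Shift Sp))) :=
    ((isDownInv_miuraT₂ h).mul h.inv_plus).mul (isDownInv_shift (-1))
  rw [h₀.invDown_eq]
  change miuraT₂ Sp * (Sp * shift 1 * invDown Sp) * invDown (miuraT₂ Sp) =
    miuraT₂ Sp * Sp * shift (-1) * shift 1 * _
  rw [h.inv_plus.invDown_eq, (isDownInv_miuraT₂ h).invDown_eq]
  let t : DownOp := ⟨miuraT₂ Sp, (isBanded_miuraT₂ Sp).1⟩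
  let ti : DownOp := ⟨_, (isDownInv_miuraT₂ h).right_isDown⟩
  let a : DownOp := ⟨Sp, h.isDown_plus⟩
  let p : DownOp := ⟨shift 1, isDown_shift 1⟩
  let p' : DownOp := ⟨shift (- -1), isDown_shift _⟩
  let q : DownOp := ⟨shift (-1), isDown_shift (-1)⟩
  let c : DownOp := ⟨_, h.inv_plus.right_isDown⟩
  have hqp : q * p = 1 := DownOp.ext (isDownInv_shift 1).4
  have hp : p' = p := DownOp.ext (congrArg shift (neg_neg 1))
  have key : t * (a * p * c) * ti = t * a * q * p * (p' * (c * ti)) := by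
    rw [mul_assoc (t * a) q p, hqp, mul_one, hp]; simp only [mul_assoc]
  exact congrArg DownOp.val key

theorem miura₂_L₂_dressing (h : IsWavePair Sp Sm) : (miura₂ Sp Sm).L₂ =
    (miura₂ Sp Sm).S₂ * shift (-1) * invUp (miura₂ Sp Sm).S₂ := by
  have h₀ : IsUpInv (miura₂ Sp Sm).S₂ (-((lamSub * Sp * shift (-1)).adj *
      (cofactor * -lamInv.adj * b0Shift Sp))) :=
    ((isUpInv_miuraT₂ h).mul h.inv_minus.adj).neg
  rw [h₀.invUp_eq]
  change miuraT₂ Sp * (Sm.adj * shift (-1) * invUp Sm.adj) * invUp (miuraT₂ Sp) =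
    -(miuraT₂ Sp * Sm.adj) * shift (-1) * _
  rw [h.inv_minus.adj.invUp_eq, (isUpInv_miuraT₂ h).invUp_eq]
  let t : UpOp := ⟨miuraT₂ Sp, (isBanded_miuraT₂ Sp).2⟩
  let ti : UpOp := ⟨_, (isUpInv_miuraT₂ h).right_isUp⟩
  let a : UpOp := ⟨Sm.adj, h.isDown_minus.adj⟩
  let q : UpOp := ⟨shift (-1), isUp_shift (-1)⟩
  let c : UpOp := ⟨_, h.inv_minus.adj.right_isUp⟩
  have key : t * (a * q * c) * ti = -(t * a) * q * -(c * ti) := by noncomm_ring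
  exact congrArg UpOp.val key

theorem miura₂_hasTodaForm (h : IsWavePair Sp Sm) : (miura₂ Sp Sm).HasTodaForm := by
  have hinv₁ := miura₂_inv₁ h
  have hinv₂ := miura₂_inv₂ h
  have hT := isBanded_miuraT₂ Sp
  have hg := isBanded_b0Shift Sp
  have hu : IsBanded (shift 1 + 1) := (isBanded_shift 1).add isBanded_one
  have hp := h.isDown_plus
  have hm := h.isDown_minus.adj
  have hTS : OrderLE (1 + 0) (miuraT₂ Sp * Sp) := (orderLE_miuraT₂ Sp).mul h.plus_form
  have hTS' : OrderGE (0 + 0) (miuraT₂ Sp * Sm.adj) :=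
    (orderGE_miuraT₂ Sp).mul (OrderLE.adj (N := 0) h.minus_form)
  have hS₁ : OrderLE 0 (miura₂ Sp Sm).S₁ := fun j n hj =>
    (coeff_mul_shift _ _ _ _).trans (hTS _ _ (by lia))
  have hS₂ : OrderGE 0 (miura₂ Sp Sm).S₂ := fun j n hj =>
    neg_eq_zero.2 (hTS' j n (by lia))
  have hlead₁ : ∀ n, (miura₂ Sp Sm).S₁.coeff 0 n = 1 := fun n => by
    refine (coeff_mul_shift _ _ _ _).trans ?_
    refine ((orderLE_miuraT₂ Sp).coeff_mul_lead (b := 0) h.plus_form n).trans ?_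
    rw [coeff_miuraT₂, if_pos rfl, if_neg one_ne_zero, sub_zero, mul_one]
    exact h.inv_mul_b0 (n + 1)
  have hlead₂ : ∀ n, IsUnit ((miura₂ Sp Sm).S₂.coeff 0 n) := fun n => by
    have h₁ : (miuraT₂ Sp * Sm.adj).coeff 0 n = (miuraT₂ Sp).coeff 0 n * Sm.adj.coeff 0 (n + 0) :=
      (orderGE_miuraT₂ Sp).coeff_mul_lead (OrderLE.adj (N := 0) h.minus_form) n
    have h₂ : (miura₂ Sp Sm).S₂.coeff 0 n = (b0 Sp (n + 1))⁻¹ * Sm.coeff 0 n := by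
      refine (congrArg Neg.neg h₁).trans ?_
      rw [coeff_miuraT₂, if_neg zero_ne_one, if_pos rfl, coeff_adj, neg_zero, add_zero, add_zero]
      ring
    rw [h₂]
    exact (IsUnit.of_mul_eq_one _ (h.inv_mul_b0 (n + 1))).mul (h.isUnit_minus n)
  have hd₁ := miura₂_L₁_dressing h
  have hd₂ := miura₂_L₂_dressing h
  have hL₁ := lax_form_down hS₁ hlead₁ hinv₁ (hinv₁.invDown_eq ▸ hd₁)
  have hL₂ := lax_form_up hS₂ hlead₂ hinv₂ (hinv₂.invUp_eq ▸ hd₂)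
  refine ⟨hS₁, hlead₁, hS₂, hlead₂, hL₁.1, hL₁.2, hL₂.1, hL₂.2, hd₁, hd₂, ?_, ?_, ?_, ?_⟩
  · change act (miuraT₂ Sp) (act Sp (zmul (-1) (expUp 1))) = _
    rw [zmul_expUp, ← act_mul_shift, ← act_mul hT _ (locFin_expUp 1),
      ← IsDown.mul_assoc hT.1 hp (isDown_shift (-1))]
    rfl
  · change -act (miuraT₂ Sp) (act Sm.adj (zmul (-1) (zinv (zmul (-1) (expDownNeg (-1)))))) = _
    rw [zmul_zinv_zmul_expDownNeg, ← act_mul hT _ (locFin_expDown _), ← act_neg]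
    rfl
  · change act (b0Shift Sp * (shift 1 + 1))
      (act Sm.adj (zmul 1 (zmul (-1) (expDownNeg (-1))))) = _
    rw [zmul_zmul_expDownNeg, ← act_mul (hg.mul hu) _ (locFin_expDownNeg _), hinv₁.invDown_eq,
      adj_mul, adj_mul, adj_cofactor, adj_b0Shift, IsUp.mul_assoc hg.2 hu.2 hm]
  · change act (b0Shift Sp * (shift 1 + 1)) (act Sp (zmul 1 (zinv (expUp 1)))) = _
    rw [zmul_zinv_expUp, ← act_mul_shift, ← act_mul (hg.mul hu) _ (locFin_expUpNeg _),
      hinv₂.invUp_eq, adj_mul, adj_mul, adj_mul, adj_cofactor, adj_b0Shift, adj_adj, adj_shift,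
      IsDown.mul_assoc hg.1 hu.1 (hp.mul (isDown_shift _))]

/-- `B_k` is right divisible by `Λ - Λ⁻¹`, hence by `Δ`, so its gauge transform by `T₂` is again
a difference operator. -/
theorem exists_gauge_miuraT₂ (h : IsWavePair Sp Sm) (k : ℕ+) :
    ∃ M, IsBanded M ∧ M * miuraT₂ Sp = miuraT₂ Sp * bkpB Sp Sm k + pd k (miuraT₂ Sp) := by
  obtain ⟨C, hC, hB⟩ := isBanded_bkpB_factor h k
  have hT := isBanded_miuraT₂ Sp
  have hg := isBanded_b0Shift Sp
  have hgi := isBanded_b0ShiftInv Sp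
  refine ⟨miuraT₂ Sp * C * cofactor * b0Shift Sp + pd k (b0ShiftInv Sp) * b0Shift Sp,
    (((hT.mul hC).mul isBanded_cofactor).mul hg).add ((hgi.pd k).mul hg), ?_⟩
  have hpd : pd k (miuraT₂ Sp) = pd k (b0ShiftInv Sp) * delta := by
    change pd k (b0ShiftInv Sp * delta) = _
    have hdelta : pd k delta = 0 := by rw [delta, pd_sub, pd_shift, pd_one, sub_zero]
    rw [pd_mul_of_isDown k hgi.1 isBanded_delta.1, hdelta, PDO.mul_zero, add_zero]
  rw [hpd, hB]
  let t : DownOp := ⟨miuraT₂ Sp, hT.1⟩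
  let c : DownOp := ⟨C, hC.1⟩
  let u : DownOp := ⟨cofactor, isBanded_cofactor.1⟩
  let d : DownOp := ⟨delta, isBanded_delta.1⟩
  let l : DownOp := ⟨lamSub, isDown_lamSub⟩
  let g : DownOp := ⟨b0Shift Sp, hg.1⟩
  let gi : DownOp := ⟨b0ShiftInv Sp, hgi.1⟩
  let dgi : DownOp := ⟨pd k (b0ShiftInv Sp), hgi.1.pd k⟩
  have ht : t = gi * d := rfl
  have hgg : g * gi = 1 := DownOp.ext (isDownInv_b0ShiftInv h).4
  have hl : u * d = l := DownOp.ext cofactor_mul_delta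
  have key : (t * c * u * g + dgi * g) * t = t * (c * l) + dgi * d := by
    calc (t * c * u * g + dgi * g) * t = t * c * u * (g * gi) * d + dgi * (g * gi) * d := by
          rw [ht]; noncomm_ring
      _ = t * c * (u * d) + dgi * d := by rw [hgg, mul_one, mul_one, mul_assoc (t * c)]
      _ = t * (c * l) + dgi * d := by rw [hl, mul_assoc]
  exact congrArg DownOp.val key

theorem miura₂_todaFlow (h : IsWavePair Sp Sm) :
    ∃ M, TodaFlow (miura₂ Sp Sm).S₁ (Sm * cofactor * b0Shift Sp) (miura₂ Sp Sm).S₂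
      (shift 1 * Sp.adj * cofactor * b0Shift Sp) M := by
  choose M hM hMT using exists_gauge_miuraT₂ h
  have hT := isBanded_miuraT₂ Sp
  refine ⟨M, miura₂_inv₁ h, miura₂_inv₂ h, hM, fun k => ?_, fun k => ?_⟩
  · have hflow := gauge_flow_plus h hT (hM k) (isBanded_bkpB h k) (hMT k)
    change pd k (miuraT₂ Sp * Sp * shift (-1)) = M k * (miuraT₂ Sp * Sp * shift (-1)) -
      miuraT₂ Sp * Sp * shift (-1) * shift ((k : ℕ) : ℤ)
    rw [pd_mul_of_isDown k (hT.1.mul h.isDown_plus) (isDown_shift (-1)), pd_shift, PDO.mul_zero,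
      add_zero, hflow]
    let m : DownOp := ⟨M k, (hM k).1⟩
    let s : DownOp := ⟨miuraT₂ Sp * Sp, hT.1.mul h.isDown_plus⟩
    let q : DownOp := ⟨shift (-1), isDown_shift (-1)⟩
    let pk : DownOp := ⟨shift ((k : ℕ) : ℤ), isDown_shift _⟩
    have hcomm : pk * q = q * pk := DownOp.ext <| by
      change shift ((k : ℕ) : ℤ) * shift (-1) = shift (-1) * shift ((k : ℕ) : ℤ)
      rw [shift_mul_shift, shift_mul_shift, add_comm]
    have key : (m * s - s * pk) * q = m * (s * q) - s * q * pk := by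
      rw [sub_mul, mul_assoc s pk, hcomm]; simp only [mul_assoc]
    exact congrArg DownOp.val key
  · have hflow := gauge_flow_minus h hT (hM k) (isBanded_bkpB h k) (hMT k)
    change pd k (-(miuraT₂ Sp * Sm.adj)) = M k * -(miuraT₂ Sp * Sm.adj) +
      -(miuraT₂ Sp * Sm.adj) * shift (-((k : ℕ) : ℤ))
    rw [pd_neg, hflow]
    let m : UpOp := ⟨M k, (hM k).2⟩
    let s : UpOp := ⟨miuraT₂ Sp * Sm.adj, hT.2.mul h.isDown_minus.adj⟩
    let qk : UpOp := ⟨shift (-((k : ℕ) : ℤ)), isUp_shift _⟩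
    have key : -(m * s + s * qk) = m * -s + -s * qk := by noncomm_ring
    exact congrArg UpOp.val key

theorem miura₂_wave_constraint (h : IsWavePair Sp Sm) :
    (miura₂ Sp Sm).S₁ * (miura₂ Sp Sm).S₂.adj =
      -(miuraT₂ Sp * invDown lamSub * (miuraT₂ Sp).adj) := by
  have hT := isBanded_miuraT₂ Sp
  change miuraT₂ Sp * Sp * shift (-1) * (-(miuraT₂ Sp * Sm.adj)).adj = _
  rw [← h.constraint, adj_neg, adj_mul, adj_adj]
  let t : DownOp := ⟨miuraT₂ Sp, hT.1⟩
  let t' : DownOp := ⟨(miuraT₂ Sp).adj, hT.2.adj⟩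
  let a : DownOp := ⟨Sp, h.isDown_plus⟩
  let b : DownOp := ⟨Sm, h.isDown_minus⟩
  let q : DownOp := ⟨shift (-1), isDown_shift (-1)⟩
  exact congrArg DownOp.val
    (show t * a * q * -(b * t') = -(t * (a * q * b) * t') by noncomm_ring)

/-- The adjoint of the wave constraint: `T₂ ι_Λ(Λ - Λ⁻¹)⁻¹ T₂^* = 𝒮₂ 𝒮₁^*`. -/
theorem miura₂_wave_constraint_adj (h : IsWavePair Sp Sm) :
    miuraT₂ Sp * invUp lamSub * (miuraT₂ Sp).adj =
      (miura₂ Sp Sm).S₂ * (miura₂ Sp Sm).S₁.adj := by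
  have hT := isBanded_miuraT₂ Sp
  have h₁ := congrArg adj (miura₂_wave_constraint h)
  rw [isDownInv_lamSub.invDown_eq, adj_mul _ (PDO.adj _), adj_adj, adj_neg,
    adj_mul _ (PDO.adj _), adj_mul _ lamInv, adj_adj] at h₁
  rw [h₁, isUpInv_lamSub.invUp_eq]
  let t : UpOp := ⟨miuraT₂ Sp, hT.2⟩
  let t' : UpOp := ⟨(miuraT₂ Sp).adj, hT.1.adj⟩
  let i : UpOp := ⟨lamInv.adj, isDownInv_lamSub.right_isDown.adj⟩
  exact congrArg UpOp.val (show t * -i * t' = -(t * (i * t')) by noncomm_ring)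

theorem miura₂_constraint (h : IsWavePair Sp Sm) :
    Constraint₂ (miuraT₂ Sp) (miura₂ Sp Sm) := by
  refine ⟨miura₂_wave_constraint h, ?_⟩
  have hT := isBanded_miuraT₂ Sp
  have hinv₁ := miura₂_inv₁ h
  have hinv₂ := miura₂_inv₂ h
  have hi : (invUp lamSub).IsUp := by rw [isUpInv_lamSub.invUp_eq]; exact isUpInv_lamSub.2
  have hLup : (miura₂ Sp Sm).L₂.IsUp := by
    rw [miura₂_L₂_dressing h, hinv₂.invUp_eq]
    exact (hinv₂.1.mul (isUp_shift (-1))).mul hinv₂.2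
  have hassoc : (miura₂ Sp Sm).L₂ * miuraT₂ Sp * invUp lamSub * (miuraT₂ Sp).adj =
      (miura₂ Sp Sm).L₂ * (miuraT₂ Sp * invUp lamSub * (miuraT₂ Sp).adj) := by
    rw [IsUp.mul_assoc hLup hT.2 hi, IsUp.mul_assoc hLup (hT.2.mul hi) hT.1.adj]
  rw [hassoc, miura₂_wave_constraint_adj h, miura₂_L₁_dressing h, miura₂_L₂_dressing h,
    hinv₁.invDown_eq, hinv₂.invUp_eq, adj_mul _ (Sm * cofactor * b0Shift Sp),
    adj_mul _ (shift 1), adj_shift]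
  let q : UpOp := ⟨shift (-1), isUp_shift (-1)⟩
  let s₁ : UpOp := ⟨_, hinv₁.left_isDown.adj⟩
  let c₁ : UpOp := ⟨_, hinv₁.right_isDown.adj⟩
  let s₂ : UpOp := ⟨_, hinv₂.left_isUp⟩
  let c₂ : UpOp := ⟨_, hinv₂.right_isUp⟩
  have hs₁ : s₁ * c₁ = 1 := UpOp.ext hinv₁.adj.3
  have hc₂ : c₂ * s₂ = 1 := UpOp.ext hinv₂.4
  have key : s₂ * s₁ * (c₁ * (q * s₁)) = s₂ * q * c₂ * (s₂ * s₁) := by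
    calc s₂ * s₁ * (c₁ * (q * s₁)) = s₂ * (s₁ * c₁) * q * s₁ := by simp only [mul_assoc]
      _ = s₂ * q * (c₂ * s₂) * s₁ := by rw [hs₁, hc₂, mul_one, mul_one]
      _ = s₂ * q * c₂ * (s₂ * s₁) := by simp only [mul_assoc]
  exact congrArg UpOp.val key

end CaseII

end LargeBKP

end

theorem mainTheorem8 (Sp Sm : LargeBKP.PDO) (h : LargeBKP.IsWavePair Sp Sm) :
    (∀ n : ℤ, IsUnit (LargeBKP.b0 Sp n)) ∧
    ((LargeBKP.miura₁ Sp Sm).HasTodaForm ∧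
      (LargeBKP.miura₁ Sp Sm).Bilinear ∧
      (LargeBKP.miura₁ Sp Sm).Evolution ∧
      LargeBKP.Constraint₁ (LargeBKP.miuraT₁ Sp) (LargeBKP.miura₁ Sp Sm)) ∧
    ((LargeBKP.miura₂ Sp Sm).HasTodaForm ∧
      (LargeBKP.miura₂ Sp Sm).Bilinear ∧
      (LargeBKP.miura₂ Sp Sm).Evolution ∧
      LargeBKP.Constraint₂ (LargeBKP.miuraT₂ Sp) (LargeBKP.miura₂ Sp Sm)) := by
  have hform₁ := LargeBKP.miura₁_hasTodaForm h
  have hflow₁ := LargeBKP.miura₁_todaFlow h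
  have hform₂ := LargeBKP.miura₂_hasTodaForm h
  obtain ⟨_, hflow₂⟩ := LargeBKP.miura₂_todaFlow h
  exact ⟨h.isUnit_b0,
    ⟨hform₁, hflow₁.bilinear hform₁, hflow₁.evolution hform₁, LargeBKP.miura₁_constraint h⟩,
    ⟨hform₂, hflow₂.bilinear hform₂, hflow₂.evolution hform₂, LargeBKP.miura₂_constraint h⟩⟩
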